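/- Setting. Two source nodes A and B exchange packets of $\ell>0$ bits through a relay D; there is no direct link. The link capacities $C_{AD},C_{DB},C_{BD},C_{DA}>0$ are constant. Put $$\Sigma_{AB}=\Big(\tfrac1{C_{AD}}+\tfrac1{C_{DB}}\Big)^{-1},\quad \Sigma_{BA}=\Big(\tfrac1{C_{BD}}+\tfrac1{C_{DA}}\Big)^{-1},\quad \Sigma_{ABA}=\Big(\tfrac1{\Sigma_{AB}}+\tfrac{C_{DA}}{C_{BD}C_{DB}}\Big)^{-1},\quad \Sigma_{BAB}=\Big(\tfrac1{\Sigma_{BA}}+\tfrac{C_{DB}}{C_{AD}C_{DA}}\Big)^{-1}.$$ Let $\mathcal R_{\rm PLNC}$ be the set of pairs $(R_{AB},R_{BA})\in[0,\infty)^2$ for which there are $\lambda_1,\lambda_2,\lambda_3\ge0$ with $\lambda_1+\lambda_2+\lambda_3=1$, $R_{AB}\le\min\{\lambda_1C_{AD},\lambda_3C_{DB}\}$ and $R_{BA}\le\min\{\lambda_2C_{BD},\lambda_3C_{DA}\}$. For integers $Q_A,Q_B\ge1$ let $(\tilde\Sigma_{ABA},\tilde\Sigma_{BAB})$ be the point of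 $\{(x,y)\in\mathcal R_{\rm PLNC}: Q_A\,y=Q_B\,x\}$ closest to $(\Sigma_{ABA},\Sigma_{BAB})$ in Euclidean distance. For an integer $Q^*$ let $\mathcal R(Q_A,Q_B,Q^*)$ be the set of $(R_{AB},R_{BA})\in[0,\infty)^2$ with $\max\{Q_A,Q_B\}<Q^*$ and $$\frac{\tilde\Sigma_{ABA}}{\Sigma_{BA}-\tilde\Sigma_{BAB}}\Big(\frac{R_{BA}}{\Sigma_{BA}}-1\Big)+\frac{R_{AB}}{\Sigma_{BA}}+\frac{Q_A}{Q^*}<0,\qquad \frac{\tilde\Sigma_{BAB}}{\Sigma_{AB}-\tilde\Sigma_{ABA}}\Big(\frac{R_{AB}}{\Sigma_{AB}}-1\Big)+\frac{R_{BA}}{\Sigma_{AB}}+\frac{Q_B}{Q^*}<0 .$$ Algorithm. Packets arrive at A and B according to independent Poisson processes with rates $\acute R_{AB},\acute R_{BA}\ge0$ (packets per unit time) and are queued. Let $(q_A,q_B)$ be the queue lengths at the end of a transmission. The next transmission is: (1) if $q_A\ge Q_A$, $q_B\ge Q_B$: $Q_A$ packets from A and $Q_B$ packets from B by PLNC; (2)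 if $q_A<Q_A$, $q_B>Q_B$: $\min\{q_B,Q^*\}$ packets from B by time-division multihop (TDMH); (3) if $q_A>Q_A$, $q_B<Q_B$: $\min\{q_A,Q^*\}$ packets from A by TDMH; (4) if $q_A<Q_A$, $q_B<Q_B$: $q_A$ packets from A and $q_B$ from B by PLNC. If $q_A<Q_A$, $q_B=Q_B$, either the action of (2) or that of (4) is taken; if $q_A=Q_A$, $q_B<Q_B$, either that of (3) or that of (4) (any fixed choice for each state). If $q_A=q_B=0$, nothing is sent during an idle slot of an arbitrary fixed length $\tau>0$. Sending $a$ packets from A and $b$ from B takes time $\frac{a\ell}{C_{AD}}+\frac{b\ell}{C_{BD}}+\max\{\frac{a\ell}{C_{DB}},\frac{b\ell}{C_{DA}}\}$ by PLNC and $\frac{a\ell}{\Sigma_{AB}}+\frac{b\ell}{\Sigma_{BA}}$ by TDMH. Let $\mathbf Q(n)$ be the queue length vector at the end of the $n$-th slot. Theorem. (i) For all $Q_A,Q_B\ge1$ the closest point $(\tilde\Sigma_{ABA},\tilde\Sigma_{BAB})$ exists and is unique. If $(R_{AB},R_{BA})=(\acute R_{AB}\ell,\acute R_{BA}\ell)\in\mathcal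 R(Q_A,Q_B,Q^*)$, then $\mathbf Q(n)$ is a time-homogeneous Markov chain and it is stable: some state is reached (or returned to) in finite mean time from every initial state. If moreover both arrival rates are positive, the chain is irreducible and every state is positive recurrent. (ii) $\mathcal R(Q_A,Q_B,Q^*)\subseteq\mathcal R_{\rm PLNC}$ for all $Q^*$, and $\mathcal R(Q_A,Q_B,Q^*)$ is nondecreasing in $Q^*$. (iii) If $Q_A/Q_B=\Sigma_{ABA}/\Sigma_{BAB}$, then $\mathcal R(Q_A,Q_B,Q^*)\to\mathcal R_{\rm PLNC}$ in Hausdorff distance as $Q^*\to\infty$. In general, for every $\varepsilon>0$ there is $\delta>0$ such that for all $Q_A,Q_B\ge1$ with $|Q_A/Q_B-\Sigma_{ABA}/\Sigma_{BAB}|<\delta$ the Hausdorff distance between $\mathcal R(Q_A,Q_B,Q^*)$ and $\mathcal R_{\rm PLNC}$ is less than $\varepsilon$ for all sufficiently large $Q^*$. -/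

import Mathlib

open MeasureTheory ProbabilityTheory Filter Topology
open scoped NNReal ENNReal

namespace TwoWayRelay

/-- Capacities (in bits per unit time) of the four links between the source nodes `A`, `B` and the
relay `D`; `CXY` is the capacity from `X` to `Y`. -/
structure Channel where
  CAD : ℝ
  CDB : ℝ
  CBD : ℝ
  CDA : ℝ
  CAD_pos : 0 < CAD
  CDB_pos : 0 < CDB
  CBD_pos : 0 < CBD
  CDA_pos : 0 < CDA

namespace Channel

variable (c : Channel)

/-- Largest one-way rate from `A` to `B` through the relay. -/
noncomputable def SigAB : ℝ := (1 / c.CAD + 1 / c.CDB)⁻¹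

/-- Largest one-way rate from `B` to `A` through the relay. -/
noncomputable def SigBA : ℝ := (1 / c.CBD + 1 / c.CDA)⁻¹

/-- Forward rate at the two-way vertex of the PLNC region. -/
noncomputable def SigABA : ℝ := (1 / c.SigAB + c.CDA / c.CBD / c.CDB)⁻¹

/-- Backward rate at the two-way vertex of the PLNC region. -/
noncomputable def SigBAB : ℝ := (1 / c.SigBA + c.CDB / c.CAD / c.CDA)⁻¹

/-- The end-to-end rate pairs `(R_AB, R_BA)` (in the first quadrant) achieved by physical-layer
network coding: two uplink phases and one broadcast phase in which each direction is served at its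
own capacity, with time fractions `l1`, `l2`, `l3`. -/
def plncRegion : Set (ℝ × ℝ) :=
  {R | 0 ≤ R.1 ∧ 0 ≤ R.2 ∧ ∃ l1 l2 l3 : ℝ, 0 ≤ l1 ∧ 0 ≤ l2 ∧ 0 ≤ l3 ∧ l1 + l2 + l3 = 1 ∧
    R.1 ≤ l1 * c.CAD ∧ R.1 ≤ l3 * c.CDB ∧ R.2 ≤ l2 * c.CBD ∧ R.2 ≤ l3 * c.CDA}

/-- The achievable rate pairs whose traffic pattern is that of a batch of `QA` packets from `A`
and `QB` packets from `B`. -/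
def batchPairs (QA QB : ℕ) : Set (ℝ × ℝ) :=
  {R | R ∈ c.plncRegion ∧ (QA : ℝ) * R.2 = (QB : ℝ) * R.1}

/-- `P` is the point of `batchPairs` closest, in Euclidean distance, to the vertex
`(SigABA, SigBAB)`. -/
def IsClosestPair (QA QB : ℕ) (P : ℝ × ℝ) : Prop :=
  P ∈ c.batchPairs QA QB ∧ ∀ R ∈ c.batchPairs QA QB,
    (P.1 - c.SigABA) ^ 2 + (P.2 - c.SigBAB) ^ 2 ≤ (R.1 - c.SigABA) ^ 2 + (R.2 - c.SigBAB) ^ 2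

/-- The rate pairs `(R_AB, R_BA)` in the first quadrant that satisfy the three inequalities for
the batch sizes `QA`, `QB`, the threshold `Qs` and the rate pair `P`. -/
def oplncRegion (QA QB Qs : ℕ) (P : ℝ × ℝ) : Set (ℝ × ℝ) :=
  {R | 0 ≤ R.1 ∧ 0 ≤ R.2 ∧
    P.1 / (c.SigBA - P.2) * (R.2 / c.SigBA - 1) + R.1 / c.SigBA + (QA : ℝ) / (Qs : ℝ) < 0 ∧
    P.2 / (c.SigAB - P.1) * (R.1 / c.SigAB - 1) + R.2 / c.SigAB + (QB : ℝ) / (Qs : ℝ) < 0 ∧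
    ((max QA QB : ℕ) : ℝ) - (Qs : ℝ) < 0}

/-- Time in which `a` packets from `A` and `b` packets from `B`, of `len` bits each, are exchanged
by PLNC: the two uplink phases, and one broadcast phase in which both directions are served
simultaneously, each at its own capacity. -/
noncomputable def plncTime (len : ℝ) (a b : ℕ) : ℝ :=
  a * len / c.CAD + b * len / c.CBD + max (a * len / c.CDB) (b * len / c.CDA)

/-- Time in which `a` packets from `A` and `b` packets from `B`, of `len` bits each, are exchanged
by time-division multihop. -/
noncomputable def tdmhTime (len : ℝ) (a b : ℕ) : ℝ :=
  (a * len / c.CAD + a * len / c.CDB) + (b * len / c.CBD + b * len / c.CDA)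

end Channel

/-- The four steps of the opportunistic PLNC scheduling algorithm. -/
inductive Step where
  | one
  | two
  | three
  | four

namespace Step

/-- `s.Allowed QA QB q`: step `s` may be taken when the queue lengths are `q = (q_A, q_B)`.
Exactly one step is allowed in every state, except for `q_A < QA, q_B = QB` (steps two and four)
and `q_A = QA, q_B < QB` (steps three and four). -/
def Allowed (QA QB : ℕ) : Step → ℕ × ℕ → Prop
  | one, q => QA ≤ q.1 ∧ QB ≤ q.2
  | two, q => q.1 < QA ∧ QB ≤ q.2
  | three, q => QA ≤ q.1 ∧ q.2 < QB
  | four, q => (q.1 < QA ∧ q.2 ≤ QB) ∨ (q.1 ≤ QA ∧ q.2 < QB)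

/-- Numbers of packets sent from `A` and from `B` in a step. -/
def sent (QA QB Qs : ℕ) : Step → ℕ × ℕ → ℕ × ℕ
  | one, _ => (QA, QB)
  | two, q => (0, min q.2 Qs)
  | three, q => (min q.1 Qs, 0)
  | four, q => q

/-- Duration of a step: steps one and four use PLNC, steps two and three use TDMH. -/
noncomputable def time (c : Channel) (len : ℝ) (QA QB Qs : ℕ) (s : Step) (q : ℕ × ℕ) : ℝ :=
  match s with
  | one | four => c.plncTime len (s.sent QA QB Qs q).1 (s.sent QA QB Qs q).2
  | two | three => c.tdmhTime len (s.sent QA QB Qs q).1 (s.sent QA QB Qs q).2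

end Step

/-- The two-way relaying system operated by the opportunistic PLNC scheduling algorithm. -/
structure System where
  /-- the link capacities -/
  c : Channel
  /-- packet length in bits -/
  len : ℝ
  len_pos : 0 < len
  /-- length of the idle slot that is inserted when both queues are empty -/
  idle : ℝ
  idle_pos : 0 < idle
  /-- batch size of node A -/
  QA : ℕ
  /-- batch size of node B -/
  QB : ℕ
  /-- the threshold -/
  Qs : ℕ
  QA_pos : 0 < QA
  QB_pos : 0 < QB
  /-- the step taken in each state -/
  step : ℕ × ℕ → Step
  step_allowed : ∀ q, (step q).Allowed QA QB q

namespace System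

variable (S : System)

/-- Duration of the slot that starts with queue lengths `q`. -/
noncomputable def slotTime (q : ℕ × ℕ) : ℝ :=
  if q = (0, 0) then S.idle else (S.step q).time S.c S.len S.QA S.QB S.Qs q

/-- Numbers of packets that leave the queues in the slot that starts with queue lengths `q`. -/
def departures (q : ℕ × ℕ) : ℕ × ℕ := (S.step q).sent S.QA S.QB S.Qs q

/-- Starting time of the `n`-th slot and queue lengths at this time, from the initial queue lengths
`q₀`, when `NA t` and `NB t` are the numbers of packets that have arrived at `A` and `B` up to
time `t`. -/
noncomputable def evolve {Ω : Type*} (NA NB : ℝ≥0 → Ω → ℕ) (q₀ : ℕ × ℕ) :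
    ℕ → Ω → ℝ≥0 × (ℕ × ℕ)
  | 0, _ => (0, q₀)
  | n + 1, ω =>
    let T := (evolve NA NB q₀ n ω).1
    let q := (evolve NA NB q₀ n ω).2
    let T1 := T + (S.slotTime q).toNNReal
    (T1, (q.1 - (S.departures q).1 + (NA T1 ω - NA T ω),
          q.2 - (S.departures q).2 + (NB T1 ω - NB T ω)))

/-- The queue length vector `Q(n)` right after the `n`-th slot. -/
noncomputable def queue {Ω : Type*} (NA NB : ℝ≥0 → Ω → ℕ) (q₀ : ℕ × ℕ) (n : ℕ) (ω : Ω) : ℕ × ℕ :=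
  (S.evolve NA NB q₀ n ω).2

end System

/-- `N` is (the counting process of) a Poisson process with rate `r`. -/
structure IsPoissonProcess {Ω : Type*} [MeasurableSpace Ω] (N : ℝ≥0 → Ω → ℕ) (r : ℝ≥0)
    (μ : Measure Ω) : Prop where
  measurable : ∀ t, Measurable (N t)
  zero : ∀ ω, N 0 ω = 0
  mono : ∀ ω, Monotone fun t => N t ω
  rightCont : ∀ ω t, ContinuousWithinAt (fun u => N u ω) (Set.Ici t) t
  indep : HasIndepIncrements N μ
  law : ∀ s t, s ≤ t → HasLaw (fun ω => N t ω - N s ω) (poissonMeasure (r * (t - s))) μ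

section Stability

variable {E Ω : Type*} [MeasurableSpace Ω]

/-- Mean of the first time `n ≥ 1` (`∞` if there is none) at which the process is in `z`. -/
noncomputable def meanPassageTime (Q : ℕ → Ω → E) (μ : Measure Ω) (z : E) : ℝ≥0∞ :=
  ∫⁻ ω, ⨅ (n : ℕ) (_ : 1 ≤ n ∧ Q n ω = z), (n : ℝ≥0∞) ∂μ

/-- The processes `X x`, started in the states `x`, are versions of one time-homogeneous Markov
chain. -/
def IsMarkovFamily (X : E → ℕ → Ω → E) (μ : Measure Ω) : Prop :=
  (∀ x, ∀ᵐ ω ∂μ, X x 0 ω = x) ∧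
  ∀ (x : E) (n : ℕ) (p : ℕ → E),
    μ {ω | ∀ k ≤ n + 1, X x k ω = p k} =
      μ {ω | ∀ k ≤ n, X x k ω = p k} * μ {ω | X (p n) 1 ω = p (n + 1)}

/-- Every state is reached from every state with positive probability. -/
def IsIrreducible (X : E → ℕ → Ω → E) (μ : Measure Ω) : Prop :=
  ∀ x z, 0 < μ {ω | ∃ n, 1 ≤ n ∧ X x n ω = z}

/-- Some state is reached in finite mean time from every initial state, itself included: there is
exactly one closed communicating class, it is positive recurrent, and it is entered in finite mean
time from everywhere. -/
def IsStable (X : E → ℕ → Ω → E) (μ : Measure Ω) : Prop :=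
  ∃ z, ∀ x, meanPassageTime (X x) μ z < ⊤

/-- Every state is positive recurrent. -/
def IsPositiveRecurrent (X : E → ℕ → Ω → E) (μ : Measure Ω) : Prop :=
  ∀ x, meanPassageTime (X x) μ x < ⊤

end Stability

end TwoWayRelay

/-!
**Geometry.** Without the time fractions, the PLNC region is the part of the first quadrant below
two lines: one through `(0, SigBA)` and one through `(SigAB, 0)`, which meet in the vertex
`V = (SigABA, SigBAB)` (`mem_plncRegion_iff`). The closest pair `P` is the projection of `V` to the
ray through `(QA, QB)`, cut off at the end of the ray in the region (`isClosestPair_iff`). As the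
threshold grows, the rate region increases to the part of the quadrant below the line through
`(0, SigBA)` and `P` and below the line through `(SigAB, 0)` and `P`. It lies in the PLNC region
because `P` does, and if `P` is near `V`, the PLNC region scaled by `1 - η` lies in it for large
thresholds, since `(0, 0)` satisfies its inequalities with room to spare. `P` is near `V` if
`QA / QB` is near `SigABA / SigBAB`.

**Markov property.** The time at which a slot starts is random, but it is a function of the queue
lengths seen before. On the event that the queue lengths follow a given path, all slots start at
deterministic times, so that independent increments turn the probability of the path into a product
of transition probabilities (`measure_path`); no strong Markov property is needed.

**Stability.** Let `m = P.2 / (SigAB - P.1)` and `n = P.1 / (SigBA - P.2)`. The gradient of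
`m x² / 2 + x y + n y² / 2` is `x (m, 1) + y (1, n)`, where `(1, n)` and `(m, 1)` are the normals of
the two lines above. Arrival rates below both lines make the mean drift of a full PLNC slot negative
along both normals, that of a TDMH slot of B negative along `(1, n)`, and that of a TDMH slot of A
negative along `(m, 1)`; in a TDMH slot the other queue is shorter than its batch and contributes a
bounded term. Hence the mean change of the quadratic form is at most `K - ε (x + y)`
(`exists_drift_le`).

Foster's criterion is used in a form that gives the passage to a single state
(`meanPassageTime_lt_top_of_rank`): a bounded function is added to the quadratic form so that the
sum decreases in mean also at the finitely many states near the origin. This needs a path of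
positive probability to the target from each of them. With no arrivals the queues run empty, and
from the empty state every state can be reached in one slot if both rates are positive. So the mean
passage time to `(0, 0)` is always finite, and that to every state is if both rates are positive;
this contains positive recurrence, and irreducibility, as a state that is reached in finite mean
time is reached almost surely.
-/

namespace TwoWayRelay

namespace Channel

/-! ### The PLNC region and its vertex -/

variable (c : Channel)

lemma one_div_SigAB : 1 / c.SigAB = 1 / c.CAD + 1 / c.CDB := by
  simp [SigAB]

lemma one_div_SigBA : 1 / c.SigBA = 1 / c.CBD + 1 / c.CDA := by
  simp [SigBA]

lemma SigAB_pos : 0 < c.SigAB := by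
  have := c.CAD_pos
  have := c.CDB_pos
  unfold SigAB
  positivity

lemma SigBA_pos : 0 < c.SigBA := by
  have := c.CBD_pos
  have := c.CDA_pos
  unfold SigBA
  positivity

lemma SigABA_pos : 0 < c.SigABA := by
  have := c.SigAB_pos
  have := c.CBD_pos
  have := c.CDA_pos
  have := c.CDB_pos
  unfold SigABA
  positivity

lemma SigBAB_pos : 0 < c.SigBAB := by
  have := c.SigBA_pos
  have := c.CAD_pos
  have := c.CDA_pos
  have := c.CDB_pos
  unfold SigBAB
  positivity

/-- Eliminating the time fractions: the PLNC region is the polygon cut out of the first quadrant by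
two half-planes, one for each direction that may be the bottleneck of the broadcast phase. -/
lemma mem_plncRegion_iff (R : ℝ × ℝ) :
    R ∈ c.plncRegion ↔ 0 ≤ R.1 ∧ 0 ≤ R.2 ∧ R.1 / c.SigAB + R.2 / c.CBD ≤ 1 ∧
      R.1 / c.CAD + R.2 / c.SigBA ≤ 1 := by
  have h1 : R.1 / c.SigAB = R.1 / c.CAD + R.1 / c.CDB := by
    rw [div_eq_mul_one_div, one_div_SigAB]; ring
  have h2 : R.2 / c.SigBA = R.2 / c.CBD + R.2 / c.CDA := by
    rw [div_eq_mul_one_div, one_div_SigBA]; ring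
  have a1 := c.CAD_pos
  have a2 := c.CDB_pos
  have a3 := c.CBD_pos
  have a4 := c.CDA_pos
  rw [h1, h2]
  constructor
  · rintro ⟨hR1, hR2, l1, l2, l3, -, -, -, hl, k1, k2, k3, k4⟩
    rw [← div_le_iff₀ (by assumption)] at k1 k2 k3 k4
    exact ⟨hR1, hR2, by linarith, by linarith⟩
  · rintro ⟨hR1, hR2, k1, k2⟩
    have b1 : 0 ≤ R.1 / c.CDB := by positivity
    refine ⟨hR1, hR2, R.1 / c.CAD, R.2 / c.CBD, 1 - R.1 / c.CAD - R.2 / c.CBD, by positivity,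
      by positivity, by linarith, by ring, ?_, ?_, ?_, ?_⟩
    all_goals rw [← div_le_iff₀ (by assumption)]
    all_goals linarith

/-- At the two-way vertex, the broadcast phase is equally long for both directions. -/
lemma SigBAB_div_CDA : c.SigBAB / c.CDA = c.SigABA / c.CDB := by
  have a1 := c.CAD_pos
  have a2 := c.CDB_pos
  have a3 := c.CBD_pos
  have a4 := c.CDA_pos
  unfold SigBAB SigABA
  rw [one_div_SigAB, one_div_SigBA]
  field_simp
  ring

lemma vertex_line_left : c.SigABA / c.SigAB + c.SigBAB / c.CBD = 1 := by
  have a2 := c.CDB_pos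
  have a3 := c.CBD_pos
  have a4 := c.CDA_pos
  have a5 := c.SigAB_pos
  have h : c.SigBAB = c.SigABA / c.CDB * c.CDA := by
    rw [← SigBAB_div_CDA]; field_simp
  have h2 : (1 / c.SigAB + c.CDA / c.CBD / c.CDB) * c.SigABA = 1 :=
    mul_inv_cancel₀ (by positivity)
  rw [h, ← h2]
  field_simp

lemma vertex_line_right : c.SigABA / c.CAD + c.SigBAB / c.SigBA = 1 := by
  have a1 := c.CAD_pos
  have a2 := c.CDB_pos
  have a4 := c.CDA_pos
  have a5 := c.SigBA_pos
  have h : c.SigABA = c.SigBAB / c.CDA * c.CDB := by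
    rw [SigBAB_div_CDA]; field_simp
  have h2 : (1 / c.SigBA + c.CDB / c.CAD / c.CDA) * c.SigBAB = 1 :=
    mul_inv_cancel₀ (by positivity)
  rw [h, ← h2]
  field_simp
  ring

lemma vertex_mem_plncRegion : (c.SigABA, c.SigBAB) ∈ c.plncRegion :=
  (c.mem_plncRegion_iff _).2 ⟨c.SigABA_pos.le, c.SigBAB_pos.le, c.vertex_line_left.le,
    c.vertex_line_right.le⟩

lemma mem_plncRegion_of_le {R R' : ℝ × ℝ} (hR : R ∈ c.plncRegion) (h1 : 0 ≤ R'.1) (h2 : 0 ≤ R'.2)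
    (h1' : R'.1 ≤ R.1) (h2' : R'.2 ≤ R.2) : R' ∈ c.plncRegion := by
  rw [mem_plncRegion_iff] at hR ⊢
  have a1 := c.CAD_pos
  have a3 := c.CBD_pos
  have a5 := c.SigAB_pos
  have a6 := c.SigBA_pos
  refine ⟨h1, h2, le_trans ?_ hR.2.2.1, le_trans ?_ hR.2.2.2⟩ <;> gcongr

lemma lt_SigAB_of_mem {R : ℝ × ℝ} (hR : R ∈ c.plncRegion) (h : 0 < R.2) : R.1 < c.SigAB := by
  rw [mem_plncRegion_iff] at hR
  have a3 := c.CBD_pos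
  have : 0 < R.2 / c.CBD := by positivity
  rw [← div_lt_one c.SigAB_pos]
  linarith [hR.2.2.1]

lemma lt_SigBA_of_mem {R : ℝ × ℝ} (hR : R ∈ c.plncRegion) (h : 0 < R.1) : R.2 < c.SigBA := by
  rw [mem_plncRegion_iff] at hR
  have a1 := c.CAD_pos
  have : 0 < R.1 / c.CAD := by positivity
  rw [← div_lt_one c.SigBA_pos]
  linarith [hR.2.2.2]

lemma SigABA_lt : c.SigABA < c.SigAB :=
  c.lt_SigAB_of_mem c.vertex_mem_plncRegion c.SigBAB_pos

lemma SigBAB_lt : c.SigBAB < c.SigBA :=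
  c.lt_SigBA_of_mem c.vertex_mem_plncRegion c.SigABA_pos

lemma mem_plncRegion_le {R : ℝ × ℝ} (hR : R ∈ c.plncRegion) : R.1 ≤ c.SigAB ∧ R.2 ≤ c.SigBA := by
  rw [mem_plncRegion_iff] at hR
  obtain ⟨h1, h2, h3, h4⟩ := hR
  have a1 := c.CAD_pos
  have a3 := c.CBD_pos
  have b1 : 0 ≤ R.2 / c.CBD := by positivity
  have b2 : 0 ≤ R.1 / c.CAD := by positivity
  rw [← div_le_one c.SigAB_pos, ← div_le_one c.SigBA_pos]
  constructor <;> linarith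

/-! ### The closest rate pair -/

lemma plncTime_pos {len : ℝ} (hl : 0 < len) {a b : ℕ} (h : 0 < a) : 0 < c.plncTime len a b := by
  have a1 := c.CAD_pos
  have a2 := c.CDB_pos
  have a3 := c.CBD_pos
  have a4 := c.CDA_pos
  have : (0 : ℝ) < a := by exact_mod_cast h
  unfold plncTime
  have : 0 ≤ max (a * len / c.CDB) (b * len / c.CDA) := le_max_of_le_left (by positivity)
  positivity

lemma smul_mem_plncRegion_iff {QA QB : ℕ} (hA : 0 < QA) (s : ℝ) :
    (s * QA, s * QB) ∈ c.plncRegion ↔ 0 ≤ s ∧ s * c.plncTime 1 QA QB ≤ 1 := by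
  have hA' : (0 : ℝ) < QA := by exact_mod_cast hA
  have hB' : (0 : ℝ) ≤ QB := Nat.cast_nonneg _
  rw [mem_plncRegion_iff]
  have k1 : s * QA / c.SigAB = s * (QA / c.CAD + QA / c.CDB) := by
    rw [div_eq_mul_one_div, one_div_SigAB]; ring
  have k2 : s * QB / c.SigBA = s * (QB / c.CBD + QB / c.CDA) := by
    rw [div_eq_mul_one_div, one_div_SigBA]; ring
  simp only [plncTime, mul_one, k1, k2]
  constructor
  · rintro ⟨h1, h2, h3, h4⟩
    have hs : 0 ≤ s := nonneg_of_mul_nonneg_left h1 hA'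
    refine ⟨hs, ?_⟩
    rw [mul_add, mul_max_of_nonneg _ _ hs, ← max_add_add_left]
    apply max_le
    · linear_combination h3
    · linear_combination h4
  · rintro ⟨hs, h⟩
    rw [mul_add, mul_max_of_nonneg _ _ hs, ← max_add_add_left, max_le_iff] at h
    refine ⟨by positivity, by positivity, ?_, ?_⟩
    · linear_combination h.1
    · linear_combination h.2

lemma mem_batchPairs_iff {QA QB : ℕ} (hA : 0 < QA) (R : ℝ × ℝ) :
    R ∈ c.batchPairs QA QB ↔
      ∃ s : ℝ, 0 ≤ s ∧ s * c.plncTime 1 QA QB ≤ 1 ∧ R = (s * QA, s * QB) := by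
  have hA' : (0 : ℝ) < QA := by exact_mod_cast hA
  constructor
  · rintro ⟨h1, h2⟩
    have e : R = (R.1 / QA * QA, R.1 / QA * QB) := by
      ext
      · simp; field_simp
      · simp only; field_simp; linarith
    have h3 := h1
    rw [e, smul_mem_plncRegion_iff c hA] at h3
    exact ⟨_, h3.1, h3.2, e⟩
  · rintro ⟨s, hs, hs', rfl⟩
    exact ⟨(smul_mem_plncRegion_iff c hA s).2 ⟨hs, hs'⟩, by simp only; ring⟩

/-- On the ray through `(QA, QB)`, the squared distance to `V` is a quadratic polynomial in the
ray parameter, minimal at the parameter of the orthogonal projection of `V`. -/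
lemma sq_dist_ray {a b : ℝ} (ha : 0 < a) (V : ℝ × ℝ) (s : ℝ) :
    (s * a - V.1) ^ 2 + (s * b - V.2) ^ 2 =
      (a ^ 2 + b ^ 2) * (s - (a * V.1 + b * V.2) / (a ^ 2 + b ^ 2)) ^ 2 +
        (b * V.1 - a * V.2) ^ 2 / (a ^ 2 + b ^ 2) := by
  have : 0 < a ^ 2 + b ^ 2 := by positivity
  field_simp
  ring

/-- The closest pair is the projection of the vertex to the ray through `(QA, QB)` or, if that
lies beyond the PLNC region, the end of the ray in the region. -/
lemma isClosestPair_iff {QA QB : ℕ} (hA : 0 < QA) (P : ℝ × ℝ) :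
    c.IsClosestPair QA QB P ↔
      P = (min (1 / c.plncTime 1 QA QB)
            ((QA * c.SigABA + QB * c.SigBAB) / ((QA : ℝ) ^ 2 + (QB : ℝ) ^ 2)) * QA,
          min (1 / c.plncTime 1 QA QB)
            ((QA * c.SigABA + QB * c.SigBAB) / ((QA : ℝ) ^ 2 + (QB : ℝ) ^ 2)) * QB) := by
  have hA' : (0 : ℝ) < QA := by exact_mod_cast hA
  have hT := c.plncTime_pos one_pos (b := QB) hA
  have hD : (0 : ℝ) < (QA : ℝ) ^ 2 + (QB : ℝ) ^ 2 := by positivity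
  have hV1 := c.SigABA_pos
  have hV2 := c.SigBAB_pos
  set T := c.plncTime 1 QA QB with hTdef
  set p := (QA * c.SigABA + QB * c.SigBAB) / ((QA : ℝ) ^ 2 + (QB : ℝ) ^ 2) with hp
  have hp0 : 0 < p := by positivity
  set m := min (1 / T) p with hm
  have hm0 : 0 ≤ m := le_min (by positivity) hp0.le
  have hmT : m * T ≤ 1 := by
    rw [← le_div_iff₀ hT]; exact min_le_left _ _
  have key : ∀ s : ℝ, s * T ≤ 1 → (m - p) ^ 2 ≤ (s - p) ^ 2 ∧
      ((s - p) ^ 2 ≤ (m - p) ^ 2 → s = m) := by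
    intro s hs
    rw [← le_div_iff₀ hT] at hs
    rcases le_total (1 / T) p with h | h
    · have e : m = 1 / T := min_eq_left h
      constructor
      · nlinarith
      · intro h'
        nlinarith [sq_nonneg (s - m)]
    · have e : m = p := min_eq_right h
      rw [e]
      refine ⟨by nlinarith [sq_nonneg (s - p)], fun h' => ?_⟩
      have : s - p = 0 := by
        apply pow_eq_zero_iff (two_ne_zero) |>.1
        nlinarith [sq_nonneg (s - p)]
      linarith
  have hmem : (m * QA, m * QB) ∈ c.batchPairs QA QB :=
    (c.mem_batchPairs_iff hA _).2 ⟨m, hm0, hmT, rfl⟩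
  have hdist : ∀ s : ℝ, (s * QA - c.SigABA) ^ 2 + (s * QB - c.SigBAB) ^ 2 =
      ((QA : ℝ) ^ 2 + (QB : ℝ) ^ 2) * (s - p) ^ 2 +
        (QB * c.SigABA - QA * c.SigBAB) ^ 2 / ((QA : ℝ) ^ 2 + (QB : ℝ) ^ 2) :=
    fun s => sq_dist_ray (b := QB) hA' (c.SigABA, c.SigBAB) s
  constructor
  · rintro ⟨h1, h2⟩
    obtain ⟨s, -, hs, rfl⟩ := (c.mem_batchPairs_iff hA _).1 h1
    have := h2 _ hmem
    simp only [hdist] at this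
    have h3 : (s - p) ^ 2 ≤ (m - p) ^ 2 := le_of_mul_le_mul_left (by linarith) hD
    rw [(key s hs).2 h3]
  · rintro rfl
    refine ⟨hmem, fun R hR => ?_⟩
    obtain ⟨s, -, hs, rfl⟩ := (c.mem_batchPairs_iff hA _).1 hR
    simp only [hdist]
    have := (key s hs).1
    gcongr

lemma existsUnique_isClosestPair {QA : ℕ} (QB : ℕ) (hA : 0 < QA) :
    ∃! P : ℝ × ℝ, c.IsClosestPair QA QB P :=
  ⟨_, (c.isClosestPair_iff hA _).2 rfl, fun _ h => (c.isClosestPair_iff hA _).1 h⟩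

variable {c} {QA QB Qs : ℕ} {P R : ℝ × ℝ}

namespace IsClosestPair

lemma mem_plncRegion (h : c.IsClosestPair QA QB P) : P ∈ c.plncRegion := h.1.1

lemma exists_smul (h : c.IsClosestPair QA QB P) (hA : 0 < QA) :
    ∃ s : ℝ, 0 < s ∧ s * c.plncTime 1 QA QB ≤ 1 ∧ P = (s * QA, s * QB) := by
  have hA' : (0 : ℝ) < QA := by exact_mod_cast hA
  have hT := c.plncTime_pos one_pos (b := QB) hA
  have hV1 := c.SigABA_pos
  have hV2 := c.SigBAB_pos
  refine ⟨_, ?_, ?_, (c.isClosestPair_iff hA P).1 h⟩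
  · exact lt_min (by positivity) (by positivity)
  · rw [← le_div_iff₀ hT]; exact min_le_left _ _

lemma fst_pos (h : c.IsClosestPair QA QB P) (hA : 0 < QA) : 0 < P.1 := by
  obtain ⟨s, hs, -, rfl⟩ := h.exists_smul hA
  have hA' : (0 : ℝ) < QA := by exact_mod_cast hA
  simp only; positivity

lemma snd_pos (h : c.IsClosestPair QA QB P) (hA : 0 < QA) (hB : 0 < QB) : 0 < P.2 := by
  obtain ⟨s, hs, -, rfl⟩ := h.exists_smul hA
  have hB' : (0 : ℝ) < QB := by exact_mod_cast hB
  simp only; positivity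

lemma fst_lt (h : c.IsClosestPair QA QB P) (hA : 0 < QA) (hB : 0 < QB) : P.1 < c.SigAB :=
  c.lt_SigAB_of_mem h.mem_plncRegion (h.snd_pos hA hB)

lemma snd_lt (h : c.IsClosestPair QA QB P) (hA : 0 < QA) : P.2 < c.SigBA :=
  c.lt_SigBA_of_mem h.mem_plncRegion (h.fst_pos hA)

end IsClosestPair

/-! ### The stability region inside the PLNC region -/

/-- The line through `(0, SigBA)` and `P` stays below the edge of the PLNC region that starts in
`(0, SigBA)`, because `P` lies in the PLNC region; similarly for `(SigAB, 0)`. -/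
lemma oplncRegion_subset (hP : c.IsClosestPair QA QB P) (hA : 0 < QA) (hB : 0 < QB) :
    c.oplncRegion QA QB Qs P ⊆ c.plncRegion := by
  rintro R ⟨hR1, hR2, h1, h2, -⟩
  have hP1 := hP.fst_pos hA
  have hP2 := hP.snd_pos hA hB
  have hPA := hP.fst_lt hA hB
  have hPB := hP.snd_lt hA
  obtain ⟨-, -, h3, h4⟩ := (c.mem_plncRegion_iff P).1 hP.mem_plncRegion
  have a1 := c.CAD_pos
  have a3 := c.CBD_pos
  have a5 := c.SigAB_pos
  have a6 := c.SigBA_pos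
  have q1 : (0 : ℝ) ≤ (QA : ℝ) / Qs := by positivity
  have q2 : (0 : ℝ) ≤ (QB : ℝ) / Qs := by positivity
  rw [mem_plncRegion_iff]
  refine ⟨hR1, hR2, ?_, ?_⟩
  · have e : P.2 / c.CBD ≤ (c.SigAB - P.1) / c.SigAB := by
      rw [sub_div, div_self a5.ne']; linarith
    have e2 : 1 / c.CBD ≤ (c.SigAB - P.1) / c.SigAB / P.2 := by
      rw [le_div_iff₀ hP2]; linarith [e, show 1 / c.CBD * P.2 = P.2 / c.CBD by ring]
    have e3 : P.2 / (c.SigAB - P.1) * (R.1 / c.SigAB - 1) + R.2 / c.SigAB < 0 := by linarith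
    have hd : 0 < c.SigAB - P.1 := by linarith
    have e4 : R.1 / c.SigAB - 1 + R.2 * ((c.SigAB - P.1) / c.SigAB / P.2) < 0 := by
      have : R.1 / c.SigAB - 1 + R.2 * ((c.SigAB - P.1) / c.SigAB / P.2) =
        (c.SigAB - P.1) / P.2 *
          (P.2 / (c.SigAB - P.1) * (R.1 / c.SigAB - 1) + R.2 / c.SigAB) := by
        field_simp
      rw [this]
      exact mul_neg_of_pos_of_neg (by positivity) e3
    have e5 : R.2 / c.CBD ≤ R.2 * ((c.SigAB - P.1) / c.SigAB / P.2) := by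
      rw [div_eq_mul_one_div]; gcongr
    linarith
  · have e : P.1 / c.CAD ≤ (c.SigBA - P.2) / c.SigBA := by
      rw [sub_div, div_self a6.ne']; linarith
    have e2 : 1 / c.CAD ≤ (c.SigBA - P.2) / c.SigBA / P.1 := by
      rw [le_div_iff₀ hP1]; linarith [e, show 1 / c.CAD * P.1 = P.1 / c.CAD by ring]
    have e3 : P.1 / (c.SigBA - P.2) * (R.2 / c.SigBA - 1) + R.1 / c.SigBA < 0 := by linarith
    have hd : 0 < c.SigBA - P.2 := by linarith
    have e4 : R.2 / c.SigBA - 1 + R.1 * ((c.SigBA - P.2) / c.SigBA / P.1) < 0 := by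
      have : R.2 / c.SigBA - 1 + R.1 * ((c.SigBA - P.2) / c.SigBA / P.1) =
        (c.SigBA - P.2) / P.1 *
          (P.1 / (c.SigBA - P.2) * (R.2 / c.SigBA - 1) + R.1 / c.SigBA) := by
        field_simp
      rw [this]
      exact mul_neg_of_pos_of_neg (by positivity) e3
    have e5 : R.1 / c.CAD ≤ R.1 * ((c.SigBA - P.2) / c.SigBA / P.1) := by
      rw [div_eq_mul_one_div]; gcongr
    linarith

lemma oplncRegion_mono :
    Monotone fun Qs : ℕ => c.oplncRegion QA QB Qs P := by
  rintro Q Q' hQ R ⟨hR1, hR2, h1, h2, h3⟩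
  have hQ' : (Q : ℝ) ≤ Q' := by exact_mod_cast hQ
  -- The last inequality keeps `Q` away from `0`, where `QA / Q` has a junk value.
  have hQ0 : (0 : ℝ) < Q := by
    have : (0 : ℝ) ≤ ((max QA QB : ℕ) : ℝ) := Nat.cast_nonneg _
    linarith
  have k1 : (QA : ℝ) / Q' ≤ QA / Q := by gcongr
  have k2 : (QB : ℝ) / Q' ≤ QB / Q := by gcongr
  exact ⟨hR1, hR2, by linarith, by linarith, by linarith⟩

/-! ### Approximation of the PLNC region -/

/-- If the traffic pattern of the batch is close to that of the vertex, then so is the closest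
pair to the vertex: lowering one coordinate of the vertex gives a competitor on the ray. -/
lemma IsClosestPair.near_vertex (c : Channel) {ρ : ℝ} (hρ : 0 < ρ) :
    ∃ δ : ℝ, 0 < δ ∧ ∀ (QA QB : ℕ) (P : ℝ × ℝ), 0 < QA → 0 < QB →
      |(QA : ℝ) / (QB : ℝ) - c.SigABA / c.SigBAB| < δ → c.IsClosestPair QA QB P →
      |P.1 - c.SigABA| < ρ ∧ |P.2 - c.SigBAB| < ρ := by
  have hV1 := c.SigABA_pos
  have hV2 := c.SigBAB_pos
  set V1 := c.SigABA with hV1def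
  set V2 := c.SigBAB with hV2def
  refine ⟨min (ρ / V2) (ρ * V1 / V2 ^ 2), lt_min (by positivity) (by positivity), ?_⟩
  intro QA QB P hA hB hd hP
  have hA' : (0 : ℝ) < QA := by exact_mod_cast hA
  have hB' : (0 : ℝ) < QB := by exact_mod_cast hB
  obtain ⟨hd1, hd2⟩ := lt_min_iff.1 hd
  rw [abs_lt] at hd1 hd2
  suffices h : ∃ R ∈ c.batchPairs QA QB, (R.1 - V1) ^ 2 + (R.2 - V2) ^ 2 < ρ ^ 2 by
    obtain ⟨R, hR, hlt⟩ := h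
    have := hP.2 R hR
    constructor <;> apply abs_lt_of_sq_lt_sq _ hρ.le <;>
      nlinarith [sq_nonneg (P.1 - V1), sq_nonneg (P.2 - V2)]
  rcases le_total ((QA : ℝ) / QB) (V1 / V2) with h | h
  · have h' : (QA : ℝ) / QB * V2 ≤ V1 := by rwa [le_div_iff₀ hV2] at h
    refine ⟨((QA : ℝ) / QB * V2, V2), ⟨?_, by simp only; field_simp⟩, ?_⟩
    · exact c.mem_plncRegion_of_le c.vertex_mem_plncRegion (by simp only; positivity) hV2.le h'
        le_rfl
    · have : V1 - (QA : ℝ) / QB * V2 < ρ := by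
        have e : V1 - (QA : ℝ) / QB * V2 = -((QA : ℝ) / QB - V1 / V2) * V2 := by field_simp; ring
        rw [e, ← lt_div_iff₀ hV2]; linarith
      simp only
      nlinarith
  · have hr : (0 : ℝ) < QA / QB := by positivity
    have h' : V1 / ((QA : ℝ) / QB) ≤ V2 := by
      rw [div_le_iff₀ hV2] at h
      rw [div_le_iff₀ hr]; linarith
    refine ⟨(V1, V1 / ((QA : ℝ) / QB)), ⟨?_, by simp only; field_simp⟩, ?_⟩
    · exact c.mem_plncRegion_of_le c.vertex_mem_plncRegion hV1.le (by simp only; positivity)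
        le_rfl h'
    · have : V2 - V1 / ((QA : ℝ) / QB) < ρ := by
        have e : V2 - V1 / ((QA : ℝ) / QB) =
            ((QA : ℝ) / QB - V1 / V2) * V2 / (QA / QB) := by field_simp
        rw [e, div_lt_iff₀ hr]
        calc ((QA : ℝ) / QB - V1 / V2) * V2 < ρ * V1 / V2 ^ 2 * V2 := by gcongr; exact hd2.2
          _ = ρ * (V1 / V2) := by field_simp
          _ ≤ ρ * (QA / QB) := by gcongr
      simp only
      nlinarith

lemma vertex_slope_right : c.SigABA / (c.SigBA - c.SigBAB) = c.CAD / c.SigBA := by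
  have h := c.vertex_line_right
  have a1 := c.CAD_pos
  have a6 := c.SigBA_pos
  have h2 := c.SigBAB_lt
  rw [div_eq_div_iff (by linarith) a6.ne']
  field_simp at h
  linarith

lemma vertex_slope_left : c.SigBAB / (c.SigAB - c.SigABA) = c.CBD / c.SigAB := by
  have h := c.vertex_line_left
  have a1 := c.CBD_pos
  have a6 := c.SigAB_pos
  have h2 := c.SigABA_lt
  rw [div_eq_div_iff (by linarith) a6.ne']
  field_simp at h
  linarith

/-- Scaling a rate pair of the PLNC region by `1 - η` moves it below the line through `(0, S)` with
slope parameter `κP` by a uniform margin, provided that `κP` is close to the slope parameter `κV`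
of the edge of the region. -/
lemma scaled_line_le {κV κP η x y S : ℝ} (hη1 : η < 1) (hy : 0 ≤ y) (hS : 0 < S) (hyS : y ≤ S)
    (hV : κV * (y / S - 1) + x / S ≤ 0) :
    κP * ((1 - η) * y / S - 1) + (1 - η) * x / S ≤ -min (κP - (1 - η) * κV) (η * κP) := by
  have h0 : 0 ≤ y / S := by positivity
  have h1 : y / S ≤ 1 := (div_le_one hS).2 hyS
  have e1 : (1 - η) * y / S = (1 - η) * (y / S) := by ring
  have e2 : (1 - η) * x / S = (1 - η) * (x / S) := by ring
  rw [e1, e2]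
  have h2 : (1 - η) * (x / S) ≤ (1 - η) * (κV * (1 - y / S)) := by
    apply mul_le_mul_of_nonneg_left _ (by linarith); linarith
  -- The bound is affine in `y / S`; the two terms of the minimum are its values at `0` and `1`.
  have h3 := mul_le_mul_of_nonneg_left (min_le_left (κP - (1 - η) * κV) (η * κP))
    (sub_nonneg.2 h1)
  have h4 := mul_le_mul_of_nonneg_left (min_le_right (κP - (1 - η) * κV) (η * κP)) h0
  nlinarith

lemma eventually_hausdorffEDist_lt (c : Channel) {ε : ℝ≥0∞} (hε : 0 < ε) :
    ∃ δ : ℝ, 0 < δ ∧ ∀ (QA QB : ℕ) (P : ℝ × ℝ), 0 < QA → 0 < QB →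
      |(QA : ℝ) / (QB : ℝ) - c.SigABA / c.SigBAB| < δ → c.IsClosestPair QA QB P →
      ∀ᶠ Qs : ℕ in atTop,
        Metric.hausdorffEDist (c.oplncRegion QA QB Qs P) c.plncRegion < ε := by
  obtain ⟨e, -, he0, heε⟩ := ENNReal.lt_iff_exists_real_btwn.1 hε
  have he : 0 < e := ENNReal.ofReal_pos.1 he0
  have hSA := c.SigAB_pos
  have hSB := c.SigBA_pos
  have hV1 := c.SigABA_pos
  have hV2 := c.SigBAB_pos
  have hV1' := c.SigABA_lt
  have hV2' := c.SigBAB_lt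
  have hCA := c.CAD_pos
  have hCB := c.CBD_pos
  obtain ⟨η, hη, hη1, hηA, hηB⟩ : ∃ η : ℝ, 0 < η ∧ η < 1 ∧ η * c.SigAB ≤ e ∧ η * c.SigBA ≤ e := by
    refine ⟨min (1 / 2) (min (e / c.SigAB) (e / c.SigBA)), by positivity, ?_, ?_, ?_⟩
    · exact (min_le_left _ _).trans_lt (by norm_num)
    · rw [← le_div_iff₀ hSA]; exact (min_le_right _ _).trans (min_le_left _ _)
    · rw [← le_div_iff₀ hSB]; exact (min_le_right _ _).trans (min_le_right _ _)
  obtain ⟨ρ, hρ, hρP⟩ : ∃ ρ : ℝ, 0 < ρ ∧ ∀ P : ℝ × ℝ, |P.1 - c.SigABA| < ρ → |P.2 - c.SigBAB| < ρ →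
      (1 - η) * (c.CAD / c.SigBA) < P.1 / (c.SigBA - P.2) ∧
      (1 - η) * (c.CBD / c.SigAB) < P.2 / (c.SigAB - P.1) := by
    have c1 : ContinuousAt (fun P : ℝ × ℝ => P.1 / (c.SigBA - P.2)) (c.SigABA, c.SigBAB) :=
      ContinuousAt.div (by fun_prop) (by fun_prop) (sub_ne_zero.2 hV2'.ne')
    have c2 : ContinuousAt (fun P : ℝ × ℝ => P.2 / (c.SigAB - P.1)) (c.SigABA, c.SigBAB) :=
      ContinuousAt.div (by fun_prop) (by fun_prop) (sub_ne_zero.2 hV1'.ne')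
    have k1 : (1 - η) * (c.CAD / c.SigBA) < c.SigABA / (c.SigBA - c.SigBAB) := by
      rw [vertex_slope_right]
      have : 0 < c.CAD / c.SigBA := by positivity
      nlinarith
    have k2 : (1 - η) * (c.CBD / c.SigAB) < c.SigBAB / (c.SigAB - c.SigABA) := by
      rw [vertex_slope_left]
      have : 0 < c.CBD / c.SigAB := by positivity
      nlinarith
    obtain ⟨ρ, hρ, h⟩ := Metric.eventually_nhds_iff.1
      ((c1.eventually_const_lt k1).and (c2.eventually_const_lt k2))
    refine ⟨ρ, hρ, fun P h1 h2 => h ?_⟩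
    rw [Prod.dist_eq, Real.dist_eq, Real.dist_eq]
    exact max_lt h1 h2
  obtain ⟨δ, hδ, hδP⟩ := IsClosestPair.near_vertex c hρ
  refine ⟨δ, hδ, fun QA QB P hA hB hd hP => ?_⟩
  obtain ⟨hP1, hP2⟩ := hδP QA QB P hA hB hd hP
  obtain ⟨k1, k2⟩ := hρP P hP1 hP2
  have kP1 : 0 < P.1 / (c.SigBA - P.2) :=
    div_pos (hP.fst_pos hA) (sub_pos.2 (hP.snd_lt hA))
  have kP2 : 0 < P.2 / (c.SigAB - P.1) :=
    div_pos (hP.snd_pos hA hB) (sub_pos.2 (hP.fst_lt hA hB))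
  have m1 : 0 < min (P.1 / (c.SigBA - P.2) - (1 - η) * (c.CAD / c.SigBA))
      (η * (P.1 / (c.SigBA - P.2))) := lt_min (by linarith) (by positivity)
  have m2 : 0 < min (P.2 / (c.SigAB - P.1) - (1 - η) * (c.CBD / c.SigAB))
      (η * (P.2 / (c.SigAB - P.1))) := lt_min (by linarith) (by positivity)
  filter_upwards [(tendsto_const_div_atTop_nhds_zero_nat (QA : ℝ)).eventually_lt_const m1,
    (tendsto_const_div_atTop_nhds_zero_nat (QB : ℝ)).eventually_lt_const m2,
    eventually_gt_atTop (max QA QB)] with Qs q1 q2 q3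
  refine lt_of_le_of_lt (Metric.hausdorffEDist_le_of_mem_edist ?_ ?_) heε
  · exact fun R hR => ⟨R, oplncRegion_subset hP hA hB hR, by simp⟩
  · intro R hR
    obtain ⟨hR1, hR2, h3, h4⟩ := (c.mem_plncRegion_iff R).1 hR
    obtain ⟨h5, h6⟩ := c.mem_plncRegion_le hR
    have η' : 0 ≤ 1 - η := by linarith
    have v1 : c.CAD / c.SigBA * (R.2 / c.SigBA - 1) + R.1 / c.SigBA ≤ 0 := by
      have : c.CAD / c.SigBA * (R.2 / c.SigBA - 1) + R.1 / c.SigBA =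
          c.CAD / c.SigBA * (R.1 / c.CAD + R.2 / c.SigBA - 1) := by field_simp; ring
      rw [this]
      exact mul_nonpos_of_nonneg_of_nonpos (by positivity) (by linarith)
    have v2 : c.CBD / c.SigAB * (R.1 / c.SigAB - 1) + R.2 / c.SigAB ≤ 0 := by
      have : c.CBD / c.SigAB * (R.1 / c.SigAB - 1) + R.2 / c.SigAB =
          c.CBD / c.SigAB * (R.1 / c.SigAB + R.2 / c.CBD - 1) := by field_simp; ring
      rw [this]
      exact mul_nonpos_of_nonneg_of_nonpos (by positivity) (by linarith)
    refine ⟨((1 - η) * R.1, (1 - η) * R.2), ⟨?_, ?_, ?_, ?_, ?_⟩, ?_⟩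
    · exact mul_nonneg η' hR1
    · exact mul_nonneg η' hR2
    · have := scaled_line_le (κP := P.1 / (c.SigBA - P.2)) hη1 hR2 hSB h6 v1
      simp only
      linarith
    · have := scaled_line_le (κP := P.2 / (c.SigAB - P.1)) hη1 hR1 hSA h5 v2
      simp only
      linarith
    · rw [sub_neg]; exact_mod_cast q3
    · rw [edist_dist]
      apply ENNReal.ofReal_le_ofReal
      rw [Prod.dist_eq, Real.dist_eq, Real.dist_eq]
      have e1 : R.1 - (1 - η) * R.1 = η * R.1 := by ring
      have e2 : R.2 - (1 - η) * R.2 = η * R.2 := by ring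
      simp only [e1, e2]
      rw [abs_of_nonneg (by positivity), abs_of_nonneg (by positivity)]
      apply max_le <;> nlinarith

end Channel

/-! ### Foster's criterion for Markov chains with countable state space -/

section MarkovChain

variable {E Ω : Type*} [MeasurableSpace Ω] {X : E → ℕ → Ω → E} {μ : Measure Ω}

lemma iInf_passage_le_tsum (Y : ℕ → E) (z : E) :
    ⨅ (n : ℕ) (_ : 1 ≤ n ∧ Y n = z), (n : ℝ≥0∞) ≤
      ∑' n : ℕ, Set.indicator {m : ℕ | ∀ k, 1 ≤ k → k ≤ m → Y k ≠ z} 1 n := by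
  classical
  by_cases h : ∃ n, 1 ≤ n ∧ Y n = z
  · refine (iInf₂_le (Nat.find h) (Nat.find_spec h)).trans ?_
    refine le_trans ?_ (ENNReal.sum_le_tsum (Finset.range (Nat.find h)))
    rw [Finset.sum_congr rfl (g := fun _ => 1)]
    · simp
    · intro n hn
      refine Set.indicator_of_mem (s := {m : ℕ | ∀ k, 1 ≤ k → k ≤ m → Y k ≠ z}) ?_ 1
      exact fun k h1 hk hz => Nat.find_min h (hk.trans_lt (Finset.mem_range.1 hn)) ⟨h1, hz⟩
  · push Not at h
    have : ∀ n : ℕ, Set.indicator {m : ℕ | ∀ k, 1 ≤ k → k ≤ m → Y k ≠ z} (1 : ℕ → ℝ≥0∞) n = 1 :=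
      fun n => Set.indicator_of_mem
        (s := {m : ℕ | ∀ k, 1 ≤ k → k ≤ m → Y k ≠ z}) (fun k h1 _ => h k h1) 1
    simp [this]

lemma measure_passage_pos {Y : ℕ → Ω → E} {z : E} [IsProbabilityMeasure μ]
    (h : meanPassageTime Y μ z < ⊤) : 0 < μ {ω | ∃ n, 1 ≤ n ∧ Y n ω = z} := by
  rw [pos_iff_ne_zero]
  intro h0
  refine h.ne ?_
  have hae : ∀ᵐ ω ∂μ, ⨅ (n : ℕ) (_ : 1 ≤ n ∧ Y n ω = z), (n : ℝ≥0∞) = ⊤ := by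
    have : ∀ᵐ ω ∂μ, ¬ ∃ n, 1 ≤ n ∧ Y n ω = z := by
      rw [ae_iff]; simpa using h0
    filter_upwards [this] with ω hω
    simp only [iInf_eq_top]
    exact fun n hn => absurd ⟨n, hn⟩ hω
  rw [meanPassageTime, lintegral_congr_ae hae]
  simp

variable [Countable E]

lemma lintegral_eq_tsum_fiber {F : Type*} [Countable F] (H : Ω → F)
    (hH : ∀ h, MeasurableSet {ω | H ω = h}) (f : Ω → ℝ≥0∞) :
    ∫⁻ ω, f ω ∂μ = ∑' h, ∫⁻ ω in {ω | H ω = h}, f ω ∂μ := by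
  rw [← lintegral_iUnion hH, show (⋃ h, {ω | H ω = h}) = Set.univ by ext; simp, setLIntegral_univ]
  intro a b hab
  refine Set.disjoint_left.2 fun ω h1 h2 => hab ?_
  exact Eq.trans (Eq.symm h1) h2

lemma lintegral_eq_tsum_mul {F : Type*} [Countable F] (H : Ω → F)
    (hH : ∀ h, MeasurableSet {ω | H ω = h}) (s : Set Ω) (g : F → ℝ≥0∞) :
    ∫⁻ ω in s, g (H ω) ∂μ = ∑' h, g h * μ ({ω | H ω = h} ∩ s) := by
  rw [lintegral_eq_tsum_fiber H hH]
  congr 1; ext h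
  rw [setLIntegral_congr_fun (g := fun _ => g h) (hH h) (fun ω hω => by rw [hω]),
    setLIntegral_const, Measure.restrict_apply (hH h)]

/-- One-step Markov property, integrated over an event `{path ∈ A}` of the past. -/
lemma IsMarkovFamily.setLIntegral_succ (hX : IsMarkovFamily X μ)
    (hm : ∀ x n z, MeasurableSet {ω | X x n ω = z}) (W : E → ℝ≥0∞) (x : E) (n : ℕ)
    (A : Set (Fin (n + 1) → E)) :
    ∫⁻ ω in {ω | (fun k : Fin (n + 1) => X x k ω) ∈ A}, W (X x (n + 1) ω) ∂μ =
      ∫⁻ ω in {ω | (fun k : Fin (n + 1) => X x k ω) ∈ A}, (∫⁻ ω', W (X (X x n ω) 1 ω') ∂μ) ∂μ := by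
  set H : Ω → Fin (n + 1) → E := fun ω k => X x k ω with hHdef
  have hH : ∀ h, MeasurableSet {ω | H ω = h} := by
    intro h
    have : {ω | H ω = h} = ⋂ k : Fin (n + 1), {ω | X x k ω = h k} := by
      ext ω; simp [H, funext_iff]
    rw [this]
    exact MeasurableSet.iInter fun k => hm _ _ _
  have hA : MeasurableSet {ω | H ω ∈ A} := by
    have : {ω | H ω ∈ A} = ⋃ h ∈ A, {ω | H ω = h} := by ext ω; simp
    rw [this]
    exact MeasurableSet.biUnion A.to_countable fun h _ => hH h
  change ∫⁻ ω in {ω | H ω ∈ A}, W (X x (n + 1) ω) ∂μ =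
    ∫⁻ ω in {ω | H ω ∈ A}, (∫⁻ ω', W (X (X x n ω) 1 ω') ∂μ) ∂μ
  rw [lintegral_eq_tsum_fiber H hH, lintegral_eq_tsum_fiber H hH]
  congr 1; ext h
  rw [Measure.restrict_restrict (hH h)]
  by_cases hhA : h ∈ A
  swap
  · have : {ω | H ω = h} ∩ {ω | H ω ∈ A} = ∅ := by
      ext ω
      simp only [Set.mem_inter_iff, Set.mem_ofPred_eq, Set.mem_empty_iff_false, iff_false, not_and]
      rintro rfl; exact hhA
    rw [this]; simp
  have hsub : {ω | H ω = h} ∩ {ω | H ω ∈ A} = {ω | H ω = h} := by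
    ext ω
    simp only [Set.mem_inter_iff, Set.mem_ofPred_eq, and_iff_left_iff_imp]
    rintro rfl; exact hhA
  have hR : ∫⁻ ω in {ω | H ω = h}, (∫⁻ ω', W (X (X x n ω) 1 ω') ∂μ) ∂μ =
      ∫⁻ _ in {ω | H ω = h}, (∫⁻ ω', W (X (h (Fin.last n)) 1 ω') ∂μ) ∂μ := by
    refine setLIntegral_congr_fun (hH h) ?_
    rintro ω rfl
    simp [H]
  rw [hsub, hR, setLIntegral_const, lintegral_eq_tsum_mul (X x (n + 1)) (hm x (n + 1)) _ W,
    ← setLIntegral_univ, lintegral_eq_tsum_mul (X (h (Fin.last n)) 1) (hm _ 1) _ W,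
    ← ENNReal.tsum_mul_right]
  congr 1; ext y
  rw [mul_assoc, Set.inter_univ]
  congr 1
  let p : ℕ → E := fun k => if hk : k < n + 1 then h ⟨k, hk⟩ else y
  have e1 : {ω | X x (n + 1) ω = y} ∩ {ω | H ω = h} = {ω | ∀ k ≤ n + 1, X x k ω = p k} := by
    ext ω
    simp only [Set.mem_inter_iff, Set.mem_ofPred_eq, H, funext_iff, Fin.forall_iff, p]
    constructor
    · rintro ⟨h1, h2⟩ k hk
      by_cases hk' : k < n + 1
      · simpa [hk'] using h2 k hk'
      · obtain rfl : k = n + 1 := by omega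
        simpa using h1
    · intro h1
      refine ⟨by simpa using h1 (n + 1) le_rfl, fun k hk => by simpa [hk] using h1 k hk.le⟩
  have e2 : {ω | H ω = h} = {ω | ∀ k ≤ n, X x k ω = p k} := by
    ext ω
    simp only [Set.mem_ofPred_eq, H, funext_iff, Fin.forall_iff, p]
    constructor
    · intro h2 k hk
      simpa [Nat.lt_succ_of_le hk] using h2 k (Nat.lt_succ_of_le hk)
    · intro h1 k hk
      simpa [hk] using h1 k (Nat.le_of_lt_succ hk)
  have e3 : p n = h (Fin.last n) := by simp [p, Fin.last]
  have e4 : p (n + 1) = y := by simp [p]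
  rw [e1, e2, hX.2 x n p, e3, e4, mul_comm]

/-- A Lyapunov function whose mean decreases by at least one in every step from a state other than
`z` makes the mean passage times to `z` finite: the decrease pays for every step before the
passage. -/
lemma IsMarkovFamily.meanPassageTime_lt_top (hX : IsMarkovFamily X μ) [IsProbabilityMeasure μ]
    (hm : ∀ x n z, MeasurableSet {ω | X x n ω = z}) {W : E → ℝ≥0∞} {z : E}
    (hfin : ∀ x, ∫⁻ ω, W (X x 1 ω) ∂μ < ⊤)
    (hdrift : ∀ x, x ≠ z → ∫⁻ ω, W (X x 1 ω) ∂μ + 1 ≤ W x) (x : E) :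
    meanPassageTime (X x) μ z < ⊤ := by
  set G : ℕ → Set Ω := fun n => {ω | ∀ k, 1 ≤ k → k ≤ n → X x k ω ≠ z} with hG
  have hGm : ∀ n, MeasurableSet (G n) := by
    intro n
    have : G n = ⋂ k, ⋂ (_ : 1 ≤ k), ⋂ (_ : k ≤ n), {ω | X x k ω = z}ᶜ := by
      ext ω; simp [hG]
    rw [this]
    exact MeasurableSet.iInter fun k => MeasurableSet.iInter fun _ => MeasurableSet.iInter fun _ =>
      (hm x k z).compl
  have hGpath : ∀ n, G n = {ω | (fun k : Fin (n + 1) => X x k ω) ∈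
      {h : Fin (n + 1) → E | ∀ k : Fin (n + 1), 1 ≤ (k : ℕ) → h k ≠ z}} := by
    intro n
    ext ω
    simp only [hG, Set.mem_ofPred_eq, Fin.forall_iff]
    exact ⟨fun h k hk h1 => h k h1 (Nat.le_of_lt_succ hk),
      fun h k h1 hk => h k (Nat.lt_succ_of_le hk) h1⟩
  have hGanti : ∀ n, G (n + 1) ⊆ G n := fun n ω h k h1 hk => h k h1 (hk.trans n.le_succ)
  set a : ℕ → ℝ≥0∞ := fun n => ∫⁻ ω in G n, W (X x n ω) ∂μ with ha
  have hmeasW : ∀ n, Measurable fun ω => W (X x n ω) := by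
    intro n s hs
    have : (fun ω => W (X x n ω)) ⁻¹' s = ⋃ y ∈ W ⁻¹' s, {ω | X x n ω = y} := by
      ext ω; simp
    rw [this]
    exact MeasurableSet.biUnion (Set.to_countable _) fun y _ => hm x n y
  have hstep : ∀ n, 1 ≤ n → a (n + 1) + μ (G n) ≤ a n := by
    intro n hn
    calc a (n + 1) + μ (G n) ≤ ∫⁻ ω in G n, W (X x (n + 1) ω) ∂μ + μ (G n) := by
          gcongr
          exact lintegral_mono_set (hGanti n)
      _ = ∫⁻ ω in G n, (∫⁻ ω', W (X (X x n ω) 1 ω') ∂μ) ∂μ + ∫⁻ ω in G n, 1 ∂μ := by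
          rw [hGpath n, hX.setLIntegral_succ hm, setLIntegral_one]
      _ = ∫⁻ ω in G n, (∫⁻ ω', W (X (X x n ω) 1 ω') ∂μ + 1) ∂μ :=
          (lintegral_add_right _ measurable_const).symm
      _ ≤ a n := setLIntegral_mono (hmeasW n) fun ω hω => hdrift _ (hω n hn le_rfl)
  have hsum : ∀ N, ∑ n ∈ Finset.range N, μ (G (n + 1)) + a (N + 1) ≤ a 1 := by
    intro N
    induction N with
    | zero => simp
    | succ N ih =>
      rw [Finset.sum_range_succ]
      calc _ = ∑ n ∈ Finset.range N, μ (G (n + 1)) + (a (N + 1 + 1) + μ (G (N + 1))) := by ring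
        _ ≤ _ := (by gcongr; exact hstep (N + 1) (by omega))
        _ ≤ a 1 := ih
  have hsum' : ∑' n, μ (G n) ≤ 1 + ∫⁻ ω, W (X x 1 ω) ∂μ := by
    rw [tsum_eq_zero_add' ENNReal.summable]
    gcongr
    · exact prob_le_one
    · rw [ENNReal.tsum_eq_iSup_nat]
      exact iSup_le fun N => (le_self_add.trans (hsum N)).trans (setLIntegral_le_lintegral _ _)
  calc meanPassageTime (X x) μ z
      ≤ ∫⁻ ω, ∑' n, (G n).indicator 1 ω ∂μ := by
        refine lintegral_mono fun ω => (iInf_passage_le_tsum (fun n => X x n ω) z).trans_eq ?_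
        rfl
    _ = ∑' n, μ (G n) := by
        rw [lintegral_tsum fun n => (measurable_one.indicator (hGm n)).aemeasurable]
        congr 1; ext n
        exact lintegral_indicator_one (hGm n)
    _ ≤ _ := hsum'
    _ < ⊤ := ENNReal.add_lt_top.2 ⟨ENNReal.one_lt_top, hfin x⟩

/-- Foster's criterion with a rank function. The Lyapunov function `V` controls the states of high
rank only. From the finitely many other states the rank drops with a probability bounded below, so
that the mean of the bounded function `ρ ^ (N + 1) - ρ ^ (N + 1 - rank)` decreases there for large
`ρ`; a multiple of it is added to `V`. -/
theorem IsMarkovFamily.meanPassageTime_lt_top_of_rank (hX : IsMarkovFamily X μ)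
    [IsProbabilityMeasure μ] (hm : ∀ x n z, MeasurableSet {ω | X x n ω = z})
    {V : E → ℝ} (hV : ∀ x, 0 ≤ V x) (hint : ∀ x, Integrable (fun ω => V (X x 1 ω)) μ)
    {r : E → ℕ} (hr : ∀ N, {x | r x ≤ N}.Finite) {z : E}
    (hpos : ∀ x, x ≠ z → 0 < μ {ω | r (X x 1 ω) < r x})
    {b : ℝ} (hb : ∀ x, ∫ ω, V (X x 1 ω) ∂μ ≤ V x + b)
    {N : ℕ} (hN : ∀ x, N < r x → ∫ ω, V (X x 1 ω) ∂μ ≤ V x - 1) (x : E) :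
    meanPassageTime (X x) μ z < ⊤ := by
  have hmeas : ∀ x, ∀ s : Set E, MeasurableSet {ω | X x 1 ω ∈ s} := by
    intro x s
    have : {ω | X x 1 ω ∈ s} = ⋃ y ∈ s, {ω | X x 1 ω = y} := by ext ω; simp
    rw [this]
    exact MeasurableSet.biUnion (Set.to_countable _) fun y _ => hm x 1 y
  have hmeasf : ∀ x, ∀ f : E → ℝ, Measurable fun ω => f (X x 1 ω) :=
    fun x f s _ => hmeas x (f ⁻¹' s)
  obtain ⟨p, hp0, hp1, hp⟩ : ∃ p : ℝ, 0 < p ∧ p ≤ 1 ∧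
      ∀ x, x ≠ z → r x ≤ N → p ≤ μ.real {ω | r (X x 1 ω) < r x} := by
    have hfin : {x | r x ≤ N ∧ x ≠ z}.Finite := (hr N).subset fun x h => h.1
    rcases {x | r x ≤ N ∧ x ≠ z}.eq_empty_or_nonempty with h | h
    · refine ⟨1, one_pos, le_rfl, fun x h1 h2 => ?_⟩
      exact absurd (show x ∈ {x | r x ≤ N ∧ x ≠ z} from ⟨h2, h1⟩) (by simp [h])
    · obtain ⟨y, hy, hmin⟩ := Set.exists_min_image _
        (fun x => μ.real {ω | r (X x 1 ω) < r x}) hfin h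
      refine ⟨_, ?_, measureReal_le_one, fun x h1 h2 => hmin x ⟨h2, h1⟩⟩
      exact ENNReal.toReal_pos (hpos y hy.2).ne' (measure_ne_top _ _)
  set ρ : ℝ := 2 / p with hρ
  have hρp : p * ρ = 2 := by rw [hρ]; field_simp
  have hρ1 : 1 ≤ ρ := by rw [hρ, le_div_iff₀ hp0]; linarith
  set f : E → ℝ := fun x => ρ ^ (N + 1) - ρ ^ (N + 1 - r x) with hf
  have hf0 : ∀ x, 0 ≤ f x := fun x =>
    sub_nonneg.2 (pow_le_pow_right₀ hρ1 (Nat.sub_le _ _))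
  have hf1 : ∀ x, f x ≤ ρ ^ (N + 1) - 1 := fun x => by
    have : 1 ≤ ρ ^ (N + 1 - r x) := one_le_pow₀ hρ1
    simp only [hf]; linarith
  have hfint : ∀ x, Integrable (fun ω => f (X x 1 ω)) μ := fun x =>
    Integrable.of_bound (hmeasf x f).aestronglyMeasurable (ρ ^ (N + 1) - 1)
      (ae_of_all _ fun ω => by rw [Real.norm_eq_abs, abs_of_nonneg (hf0 _)]; exact hf1 _)
  have hfhigh : ∀ x, N < r x → ∫ ω, f (X x 1 ω) ∂μ ≤ f x := by
    intro x hx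
    have e : f x = ρ ^ (N + 1) - 1 := by
      simp only [hf, Nat.sub_eq_zero_of_le (Nat.succ_le_of_lt hx), pow_zero]
    rw [e]
    calc ∫ ω, f (X x 1 ω) ∂μ ≤ ∫ ω, (ρ ^ (N + 1) - 1) ∂μ :=
          integral_mono (hfint x) (integrable_const _) fun ω => hf1 _
      _ = _ := by simp
  have hflow : ∀ x, x ≠ z → r x ≤ N → ∫ ω, f (X x 1 ω) ∂μ ≤ f x - 1 := by
    intro x hxz hx
    set D : Set Ω := {ω | r (X x 1 ω) < r x} with hD
    have hDm : MeasurableSet D := hmeas x {y | r y < r x}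
    have hpt : ∀ ω, f (X x 1 ω) ≤ ρ ^ (N + 1) - D.indicator (fun _ => ρ ^ (N + 2 - r x)) ω := by
      intro ω
      by_cases hω : ω ∈ D
      · rw [Set.indicator_of_mem hω]
        have h1 : r (X x 1 ω) < r x := hω
        have : ρ ^ (N + 2 - r x) ≤ ρ ^ (N + 1 - r (X x 1 ω)) :=
          pow_le_pow_right₀ hρ1 (by omega)
        simp only [hf]; linarith
      · rw [Set.indicator_of_notMem hω]
        have := hf1 (X x 1 ω)
        linarith
    have hint' : Integrable (D.indicator fun _ => ρ ^ (N + 2 - r x)) μ :=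
      (integrable_const _).indicator hDm
    have h2 : ∫ ω, f (X x 1 ω) ∂μ ≤ ρ ^ (N + 1) - μ.real D * ρ ^ (N + 2 - r x) := by
      calc ∫ ω, f (X x 1 ω) ∂μ
          ≤ ∫ ω, (ρ ^ (N + 1) - D.indicator (fun _ => ρ ^ (N + 2 - r x)) ω) ∂μ :=
            integral_mono (hfint x) ((integrable_const _).sub hint') hpt
        _ = _ := by
            rw [integral_sub (integrable_const _) hint', integral_indicator_const _ hDm]
            simp
    have h3 : ρ ^ (N + 2 - r x) = ρ * ρ ^ (N + 1 - r x) := by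
      rw [← pow_succ']; congr 1; omega
    have h4 : 1 ≤ ρ ^ (N + 1 - r x) := one_le_pow₀ hρ1
    have h5 : 2 * ρ ^ (N + 1 - r x) ≤ μ.real D * ρ ^ (N + 2 - r x) := by
      rw [h3, ← hρp, mul_assoc]
      have := hp x hxz hx
      gcongr
    simp only [hf] at h2 ⊢
    linarith
  set B : ℝ := max b 0 + 1 with hB
  have hB1 : b + 1 ≤ B := by rw [hB]; gcongr; exact le_max_left _ _
  have hB0 : 0 ≤ B := by rw [hB]; have := le_max_right b 0; linarith
  set W : E → ℝ := fun x => V x + B * f x with hW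
  have hW0 : ∀ x, 0 ≤ W x := fun x => add_nonneg (hV x) (mul_nonneg hB0 (hf0 x))
  have hWint : ∀ x, Integrable (fun ω => W (X x 1 ω)) μ := fun x =>
    (hint x).add ((hfint x).const_mul B)
  have hWeq : ∀ x, ∫ ω, W (X x 1 ω) ∂μ = ∫ ω, V (X x 1 ω) ∂μ + B * ∫ ω, f (X x 1 ω) ∂μ := by
    intro x
    simp only [hW]
    rw [integral_add (hint x) ((hfint x).const_mul B), integral_const_mul]
  have hWlin : ∀ x, ∫⁻ ω, ENNReal.ofReal (W (X x 1 ω)) ∂μ =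
      ENNReal.ofReal (∫ ω, W (X x 1 ω) ∂μ) := fun x =>
    (ofReal_integral_eq_lintegral_ofReal (hWint x) (ae_of_all _ fun ω => hW0 _)).symm
  refine hX.meanPassageTime_lt_top hm (W := fun x => ENNReal.ofReal (W x)) ?_ ?_ x
  · intro x
    rw [hWlin]; exact ENNReal.ofReal_lt_top
  · intro x hx
    rw [hWlin, ← ENNReal.ofReal_one,
      ← ENNReal.ofReal_add (integral_nonneg fun ω => hW0 _) zero_le_one]
    apply ENNReal.ofReal_le_ofReal
    rw [hWeq]
    rcases lt_or_ge N (r x) with h | h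
    · have h1 := hN x h
      have h2 := mul_le_mul_of_nonneg_left (hfhigh x h) hB0
      simp only [hW]; linarith
    · have h1 := hb x
      have h2 := mul_le_mul_of_nonneg_left (hflow x hx h) hB0
      simp only [hW]; linarith

end MarkovChain

/-! ### Moments of the Poisson distribution -/

lemma hasSum_id_poisson (r : ℝ≥0) :
    HasSum (fun n : ℕ => Real.exp (-r) * r ^ n / (n.factorial : ℝ) * n) r := by
  rw [← hasSum_nat_add_iff' 1]
  have h := (hasSum_one_poissonMeasure r).mul_left (r : ℝ)
  simp only [Finset.range_one, Finset.sum_singleton, Nat.cast_zero, mul_zero, sub_zero]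
  rw [mul_one] at h
  refine h.congr_fun fun n => ?_
  rw [Nat.factorial_succ]
  push_cast
  field_simp
  ring

lemma hasSum_sq_poisson (r : ℝ≥0) :
    HasSum (fun n : ℕ => Real.exp (-r) * r ^ n / (n.factorial : ℝ) * (n : ℝ) ^ 2)
      ((r : ℝ) ^ 2 + r) := by
  rw [← hasSum_nat_add_iff' 1]
  have h := ((hasSum_id_poisson r).mul_left (r : ℝ)).add
    ((hasSum_one_poissonMeasure r).mul_left (r : ℝ))
  simp only [Finset.range_one, Finset.sum_singleton, Nat.cast_zero, mul_zero, sub_zero, ne_eq,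
    OfNat.ofNat_ne_zero, not_false_eq_true, zero_pow]
  rw [mul_one, ← sq] at h
  refine h.congr_fun fun n => ?_
  rw [Nat.factorial_succ]
  push_cast
  field_simp
  ring

lemma integrable_id_poisson (r : ℝ≥0) : Integrable (fun n : ℕ => (n : ℝ)) (poissonMeasure r) := by
  rw [integrable_poissonMeasure_iff]
  simpa using (hasSum_id_poisson r).summable

lemma integrable_sq_poisson (r : ℝ≥0) :
    Integrable (fun n : ℕ => (n : ℝ) ^ 2) (poissonMeasure r) := by
  rw [integrable_poissonMeasure_iff]
  simpa using (hasSum_sq_poisson r).summable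

lemma integral_id_poisson (r : ℝ≥0) : ∫ n : ℕ, (n : ℝ) ∂(poissonMeasure r) = r := by
  rw [integral_poissonMeasure]
  exact (hasSum_id_poisson r).tsum_eq

lemma integral_sq_poisson (r : ℝ≥0) :
    ∫ n : ℕ, (n : ℝ) ^ 2 ∂(poissonMeasure r) = (r : ℝ) ^ 2 + r := by
  rw [integral_poissonMeasure]
  exact (hasSum_sq_poisson r).tsum_eq

/-- Mean of a quadratic form of two independent Poisson variables, shifted by `(u, v)`: its value
at the mean, plus the contribution of the variances. -/
lemma integral_quadratic_poisson {Ω : Type*} [MeasurableSpace Ω] {μ : Measure Ω}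
    [IsProbabilityMeasure μ] {A B : Ω → ℕ} {a b : ℝ≥0} (hA : HasLaw A (poissonMeasure a) μ)
    (hB : HasLaw B (poissonMeasure b) μ) (hAB : IndepFun A B μ) (m n u v : ℝ) :
    Integrable (fun ω => m / 2 * (u + A ω) ^ 2 + (u + A ω) * (v + B ω) +
      n / 2 * (v + B ω) ^ 2) μ ∧
    ∫ ω, (m / 2 * (u + A ω) ^ 2 + (u + A ω) * (v + B ω) + n / 2 * (v + B ω) ^ 2) ∂μ =
      m / 2 * (u + a) ^ 2 + (u + a) * (v + b) + n / 2 * (v + b) ^ 2 + (m * a + n * b) / 2 := by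
  have iA : Integrable (fun ω => (A ω : ℝ)) μ := by
    have := integrable_id_poisson a
    rw [← hA.map_eq] at this
    exact this.comp_aemeasurable hA.aemeasurable
  have iB : Integrable (fun ω => (B ω : ℝ)) μ := by
    have := integrable_id_poisson b
    rw [← hB.map_eq] at this
    exact this.comp_aemeasurable hB.aemeasurable
  have iA2 : Integrable (fun ω => (A ω : ℝ) ^ 2) μ := by
    have := integrable_sq_poisson a
    rw [← hA.map_eq] at this
    exact this.comp_aemeasurable hA.aemeasurable
  have iB2 : Integrable (fun ω => (B ω : ℝ) ^ 2) μ := by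
    have := integrable_sq_poisson b
    rw [← hB.map_eq] at this
    exact this.comp_aemeasurable hB.aemeasurable
  have hind : IndepFun (fun ω => (A ω : ℝ)) (fun ω => (B ω : ℝ)) μ :=
    hAB.comp (φ := fun n : ℕ => (n : ℝ)) (ψ := fun n : ℕ => (n : ℝ)) .of_discrete .of_discrete
  have iAB : Integrable (fun ω => (A ω : ℝ) * (B ω : ℝ)) μ := hind.integrable_mul iA iB
  have eA : ∫ ω, (A ω : ℝ) ∂μ = a :=
    (hA.integral_comp (f := fun n : ℕ => (n : ℝ)) .of_discrete).trans (integral_id_poisson a)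
  have eB : ∫ ω, (B ω : ℝ) ∂μ = b :=
    (hB.integral_comp (f := fun n : ℕ => (n : ℝ)) .of_discrete).trans (integral_id_poisson b)
  have eA2 : ∫ ω, (A ω : ℝ) ^ 2 ∂μ = (a : ℝ) ^ 2 + a :=
    (hA.integral_comp (f := fun n : ℕ => (n : ℝ) ^ 2) .of_discrete).trans (integral_sq_poisson a)
  have eB2 : ∫ ω, (B ω : ℝ) ^ 2 ∂μ = (b : ℝ) ^ 2 + b :=
    (hB.integral_comp (f := fun n : ℕ => (n : ℝ) ^ 2) .of_discrete).trans (integral_sq_poisson b)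
  have eAB : ∫ ω, (A ω : ℝ) * (B ω : ℝ) ∂μ = a * b := by
    rw [← eA, ← eB]
    exact hind.integral_fun_mul_eq_mul_integral iA.aestronglyMeasurable iB.aestronglyMeasurable
  have expand : (fun ω => m / 2 * (u + A ω) ^ 2 + (u + A ω) * (v + B ω) + n / 2 * (v + B ω) ^ 2) =
      fun ω => (m / 2 * u ^ 2 + u * v + n / 2 * v ^ 2) + (m * u + v) * (A ω : ℝ) +
        (u + n * v) * (B ω : ℝ) + m / 2 * (A ω : ℝ) ^ 2 + n / 2 * (B ω : ℝ) ^ 2 +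
        (A ω : ℝ) * (B ω : ℝ) := by
    ext ω; ring
  rw [expand]
  have j0 : Integrable (fun _ : Ω => m / 2 * u ^ 2 + u * v + n / 2 * v ^ 2) μ :=
    integrable_const _
  have j1 := j0.fun_add (iA.const_mul (m * u + v))
  have j2 := j1.fun_add (iB.const_mul (u + n * v))
  have j3 := j2.fun_add (iA2.const_mul (m / 2))
  have j4 := j3.fun_add (iB2.const_mul (n / 2))
  refine ⟨j4.fun_add iAB, ?_⟩
  rw [integral_add j4 iAB, integral_add j3 (iB2.const_mul (n / 2)),
    integral_add j2 (iA2.const_mul (m / 2)), integral_add j1 (iB.const_mul (u + n * v)),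
    integral_add j0 (iA.const_mul (m * u + v))]
  simp only [integral_const_mul, eA, eB, eA2, eB2, eAB, integral_const, probReal_univ, one_smul]
  ring

namespace System

variable (S : System)

/-! ### The queue chain -/

/-- Duration of the slot that starts in state `q`, as a nonnegative real. -/
noncomputable def slot (q : ℕ × ℕ) : ℝ≥0 := (S.slotTime q).toNNReal

/-- Starting time of the `n`-th slot when the queue lengths follow the path `p`. -/
noncomputable def pathTime (p : ℕ → ℕ × ℕ) (n : ℕ) : ℝ≥0 := ∑ i ∈ Finset.range n, S.slot (p i)

/-- Probability of a transition from `x` to `y`, for arrival rates `rA` and `rB`. -/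
noncomputable def transProb (rA rB : ℝ≥0) (x y : ℕ × ℕ) : ℝ≥0∞ :=
  poissonMeasure (rA * S.slot x) {j | x.1 - (S.departures x).1 + j = y.1} *
    poissonMeasure (rB * S.slot x) {j | x.2 - (S.departures x).2 + j = y.2}

lemma pathTime_succ (p : ℕ → ℕ × ℕ) (n : ℕ) :
    S.pathTime p (n + 1) = S.pathTime p n + S.slot (p n) := Finset.sum_range_succ _ _

lemma pathTime_mono (p : ℕ → ℕ × ℕ) : Monotone (S.pathTime p) :=
  monotone_nat_of_le_succ fun n => by rw [pathTime_succ]; exact le_self_add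

variable {S} {Ω : Type*} {NA NB : ℝ≥0 → Ω → ℕ}

lemma evolve_eq_of_path {p : ℕ → ℕ × ℕ} {ω : Ω} {n : ℕ}
    (h : ∀ k ≤ n, S.queue NA NB (p 0) k ω = p k) :
    S.evolve NA NB (p 0) n ω = (S.pathTime p n, p n) := by
  induction n with
  | zero => simp [evolve, pathTime]
  | succ n ih =>
    have h1 := ih fun k hk => h k (hk.trans n.le_succ)
    refine Prod.ext ?_ (h (n + 1) le_rfl)
    simp only [evolve, h1, pathTime_succ]
    rfl

/-- Along a given path of queue lengths the slots start at deterministic times, so the path is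
described by the arrivals in deterministic, successive intervals. -/
lemma path_iff {p : ℕ → ℕ × ℕ} {ω : Ω} {n : ℕ} :
    (∀ k ≤ n, S.queue NA NB (p 0) k ω = p k) ↔
      (∀ k ∈ Finset.range n, NA (S.pathTime p (k + 1)) ω - NA (S.pathTime p k) ω ∈
        {j | (p k).1 - (S.departures (p k)).1 + j = (p (k + 1)).1}) ∧
      (∀ k ∈ Finset.range n, NB (S.pathTime p (k + 1)) ω - NB (S.pathTime p k) ω ∈
        {j | (p k).2 - (S.departures (p k)).2 + j = (p (k + 1)).2}) := by
  induction n with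
  | zero => simp [queue, evolve]
  | succ n ih =>
    have e : (∀ k ≤ n + 1, S.queue NA NB (p 0) k ω = p k) ↔
        (∀ k ≤ n, S.queue NA NB (p 0) k ω = p k) ∧ S.queue NA NB (p 0) (n + 1) ω = p (n + 1) := by
      simp only [Nat.le_succ_iff, or_imp, forall_and, forall_eq]
    simp only [e, Finset.range_add_one, Finset.forall_mem_insert]
    constructor
    · rintro ⟨h1, h2⟩
      have h3 := evolve_eq_of_path h1
      rw [queue, evolve, h3] at h2
      obtain ⟨h4, h5⟩ := ih.1 h1
      refine ⟨⟨?_, h4⟩, ⟨?_, h5⟩⟩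
      · rw [pathTime_succ]; exact congrArg Prod.fst h2
      · rw [pathTime_succ]; exact congrArg Prod.snd h2
    · rintro ⟨⟨h2, h4⟩, ⟨h3, h5⟩⟩
      have h1 := ih.2 ⟨h4, h5⟩
      refine ⟨h1, ?_⟩
      rw [queue, evolve, evolve_eq_of_path h1]
      rw [pathTime_succ] at h2 h3
      exact Prod.ext h2 h3

variable [MeasurableSpace Ω] {μ : Measure Ω} {rA rB : ℝ≥0}

lemma measurableSet_increment {N : ℝ≥0 → Ω → ℕ} {r : ℝ≥0} (hN : IsPoissonProcess N r μ)
    (s t : ℝ≥0) (U : Set ℕ) : MeasurableSet {ω | N t ω - N s ω ∈ U} :=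
  ((hN.measurable t).sub (hN.measurable s)) (MeasurableSet.of_discrete (s := U))

lemma measure_increments {N : ℝ≥0 → Ω → ℕ} {r : ℝ≥0} (hN : IsPoissonProcess N r μ)
    (p : ℕ → ℕ × ℕ) (n : ℕ) (U : ℕ → Set ℕ) :
    μ {ω | ∀ k ∈ Finset.range n, N (S.pathTime p (k + 1)) ω - N (S.pathTime p k) ω ∈ U k} =
      ∏ k ∈ Finset.range n, poissonMeasure (r * S.slot (p k)) (U k) := by
  have h := (hN.indep.nat (S.pathTime_mono p)).measure_inter_preimage_eq_mul (Finset.range n)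
    (sets := U) (fun i _ => MeasurableSet.of_discrete)
  have e : {ω | ∀ k ∈ Finset.range n,
      N (S.pathTime p (k + 1)) ω - N (S.pathTime p k) ω ∈ U k} =
      ⋂ k ∈ Finset.range n,
        (fun ω => N (S.pathTime p (k + 1)) ω - N (S.pathTime p k) ω) ⁻¹' U k := by
    ext ω; simp
  rw [e, h]
  refine Finset.prod_congr rfl fun k _ => ?_
  have h2 := (hN.law _ _ (S.pathTime_mono p k.le_succ)).measure_eq (p := (· ∈ U k))
    MeasurableSet.of_discrete
  rw [pathTime_succ, add_tsub_cancel_left] at h2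
  rw [pathTime_succ]
  exact h2

lemma measurableSet_path (hA : IsPoissonProcess NA rA μ) (hB : IsPoissonProcess NB rB μ)
    (x : ℕ × ℕ) (n : ℕ) (p : ℕ → ℕ × ℕ) :
    MeasurableSet {ω | ∀ k ≤ n, S.queue NA NB x k ω = p k} := by
  by_cases hx : x = p 0
  · subst hx
    simp only [path_iff]
    have : ∀ (U : ℕ → Set ℕ) {N : ℝ≥0 → Ω → ℕ} {r : ℝ≥0}, IsPoissonProcess N r μ →
        MeasurableSet {ω | ∀ k ∈ Finset.range n,
          N (S.pathTime p (k + 1)) ω - N (S.pathTime p k) ω ∈ U k} := by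
      intro U N r hN
      have e : {ω | ∀ k ∈ Finset.range n,
          N (S.pathTime p (k + 1)) ω - N (S.pathTime p k) ω ∈ U k} =
          ⋂ k ∈ Finset.range n, {ω | N (S.pathTime p (k + 1)) ω - N (S.pathTime p k) ω ∈ U k} := by
        ext ω; simp
      rw [e]
      exact Finset.measurableSet_biInter _ fun k _ => measurableSet_increment hN _ _ _
    exact (this _ hA).inter (this _ hB)
  · have : {ω | ∀ k ≤ n, S.queue NA NB x k ω = p k} = ∅ := by
      ext ω
      simp only [Set.mem_ofPred_eq, Set.mem_empty_iff_false, iff_false]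
      exact fun h => hx (h 0 n.zero_le)
    rw [this]
    exact MeasurableSet.empty

lemma measurableSet_queue (hA : IsPoissonProcess NA rA μ) (hB : IsPoissonProcess NB rB μ)
    (x : ℕ × ℕ) (n : ℕ) (z : ℕ × ℕ) : MeasurableSet {ω | S.queue NA NB x n ω = z} := by
  have e : {ω | S.queue NA NB x n ω = z} = ⋃ h ∈ {h : Fin (n + 1) → ℕ × ℕ | h (Fin.last n) = z},
      {ω | ∀ k ≤ n, S.queue NA NB x k ω = if hk : k < n + 1 then h ⟨k, hk⟩ else z} := by
    ext ω
    simp only [Set.mem_ofPred_eq, Set.mem_iUnion, exists_prop]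
    constructor
    · intro h
      refine ⟨fun k => S.queue NA NB x k ω, h, fun k hk => ?_⟩
      simp [Nat.lt_succ_of_le hk]
    · rintro ⟨h, h1, h2⟩
      rw [h2 n le_rfl, ← h1]
      simp [Fin.last]
  rw [e]
  exact MeasurableSet.biUnion (Set.to_countable _) fun h _ => measurableSet_path hA hB x n _

lemma measure_path (hA : IsPoissonProcess NA rA μ) (hB : IsPoissonProcess NB rB μ)
    (hAB : IndepFun (fun ω t => NA t ω) (fun ω t => NB t ω) μ) (p : ℕ → ℕ × ℕ) (n : ℕ) :
    μ {ω | ∀ k ≤ n, S.queue NA NB (p 0) k ω = p k} =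
      ∏ k ∈ Finset.range n, S.transProb rA rB (p k) (p (k + 1)) := by
  simp only [path_iff]
  have key : ∀ U : ℕ → Set ℕ, MeasurableSet {f : ℝ≥0 → ℕ | ∀ k ∈ Finset.range n,
      f (S.pathTime p (k + 1)) - f (S.pathTime p k) ∈ U k} := by
    intro U
    have e : {f : ℝ≥0 → ℕ | ∀ k ∈ Finset.range n,
        f (S.pathTime p (k + 1)) - f (S.pathTime p k) ∈ U k} =
        ⋂ k ∈ Finset.range n,
          (fun f : ℝ≥0 → ℕ => f (S.pathTime p (k + 1)) - f (S.pathTime p k)) ⁻¹' U k := by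
      ext f; simp
    rw [e]
    refine Finset.measurableSet_biInter _ fun k _ => ?_
    exact ((measurable_pi_apply (X := fun _ : ℝ≥0 => ℕ) (S.pathTime p (k + 1))).sub
      (measurable_pi_apply (S.pathTime p k))) MeasurableSet.of_discrete
  have h := hAB.measure_inter_preimage_eq_mul _ _
    (key fun k => {j | (p k).1 - (S.departures (p k)).1 + j = (p (k + 1)).1})
    (key fun k => {j | (p k).2 - (S.departures (p k)).2 + j = (p (k + 1)).2})
  refine h.trans ?_
  simp only [transProb, Finset.prod_mul_distrib]
  exact congrArg₂ _ (measure_increments hA p n _) (measure_increments hB p n _)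

lemma measure_queue_one (hA : IsPoissonProcess NA rA μ) (hB : IsPoissonProcess NB rB μ)
    (hAB : IndepFun (fun ω t => NA t ω) (fun ω t => NB t ω) μ) (x y : ℕ × ℕ) :
    μ {ω | S.queue NA NB x 1 ω = y} = S.transProb rA rB x y := by
  have h := measure_path hA hB hAB (S := S) (fun k => if k = 0 then x else y) 1
  simp only [Finset.range_one, Finset.prod_singleton, if_true, zero_add, one_ne_zero,
    if_false] at h
  rw [← h]
  congr 1
  ext ω
  simp only [Set.mem_ofPred_eq]
  constructor
  · intro h k hk
    interval_cases k
    · rfl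
    · simpa using h
  · intro h
    simpa using h 1 le_rfl

lemma isMarkovFamily_queue (hA : IsPoissonProcess NA rA μ) (hB : IsPoissonProcess NB rB μ)
    (hAB : IndepFun (fun ω t => NA t ω) (fun ω t => NB t ω) μ) :
    IsMarkovFamily (S.queue NA NB) μ := by
  refine ⟨fun x => ae_of_all _ fun ω => rfl, fun x n p => ?_⟩
  rw [measure_queue_one hA hB hAB]
  by_cases hx : x = p 0
  · subst hx
    rw [measure_path hA hB hAB, measure_path hA hB hAB, Finset.prod_range_succ]
  · have : ∀ m, {ω | ∀ k ≤ m, S.queue NA NB x k ω = p k} = ∅ := by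
      intro m
      ext ω
      simp only [Set.mem_ofPred_eq, Set.mem_empty_iff_false, iff_false]
      exact fun h => hx (h 0 m.zero_le)
    rw [this, this]
    simp

lemma poissonMeasure_zero_pos (r : ℝ≥0) : 0 < poissonMeasure r {0} := by
  rw [poissonMeasure_singleton, ENNReal.ofReal_pos]
  simp only [pow_zero]
  positivity

/-- With positive probability there are no arrivals in a slot. -/
lemma transProb_departures_pos (x : ℕ × ℕ) :
    0 < S.transProb rA rB x (x.1 - (S.departures x).1, x.2 - (S.departures x).2) := by
  unfold transProb
  simp only [Nat.add_eq_left, Set.ofPred_eq_eq_singleton]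
  exact ENNReal.mul_pos (poissonMeasure_zero_pos _).ne' (poissonMeasure_zero_pos _).ne'

lemma departures_le (x : ℕ × ℕ) :
    (S.departures x).1 ≤ x.1 ∧ (S.departures x).2 ≤ x.2 := by
  have h := S.step_allowed x
  unfold departures
  cases hs : S.step x <;> rw [hs] at h <;> simp only [Step.Allowed, Step.sent] at h ⊢ <;>
    omega

lemma departures_le_threshold (hQA : S.QA < S.Qs) (hQB : S.QB < S.Qs) (x : ℕ × ℕ) :
    (S.departures x).1 ≤ S.Qs ∧ (S.departures x).2 ≤ S.Qs := by
  have h := S.step_allowed x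
  unfold departures
  cases hs : S.step x <;> rw [hs] at h <;> simp only [Step.Allowed, Step.sent] at h ⊢ <;>
    omega

/-- In every slot that is not idle some packet is sent. -/
lemma departures_pos (hQs : 0 < S.Qs) {x : ℕ × ℕ} (hx : x ≠ (0, 0)) :
    0 < (S.departures x).1 + (S.departures x).2 := by
  have h := S.step_allowed x
  have hA := S.QA_pos
  have hB := S.QB_pos
  have hx' : x.1 ≠ 0 ∨ x.2 ≠ 0 := by
    by_contra h; push Not at h; exact hx (Prod.ext h.1 h.2)
  unfold departures
  cases hs : S.step x <;> rw [hs] at h <;> simp only [Step.Allowed, Step.sent] at h ⊢ <;>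
    omega

lemma departures_zero : S.departures (0, 0) = (0, 0) := by
  have h := departures_le (S := S) (0, 0)
  exact Prod.ext (by simpa using h.1) (by simpa using h.2)

/-- From the empty state, every state is reached in one slot if packets arrive at both nodes. -/
lemma transProb_zero_pos (hrA : 0 < rA) (hrB : 0 < rB) (z : ℕ × ℕ) :
    0 < S.transProb rA rB (0, 0) z := by
  have hs : 0 < S.slot (0, 0) := by simp [slot, slotTime, S.idle_pos]
  have key : ∀ (r : ℝ≥0) (n : ℕ), 0 < r → 0 < poissonMeasure (r * S.slot (0, 0)) {n} := by
    intro r n hr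
    exact (ENNReal.toReal_pos_iff.1 (poissonMeasure_real_singleton_pos n (mul_pos hr hs))).1
  simp only [transProb, departures_zero, Nat.sub_zero, zero_add, Set.ofPred_eq_eq_singleton]
  exact ENNReal.mul_pos (key rA z.1 hrA).ne' (key rB z.2 hrB).ne'

end System

/-! ### Drift of the quadratic Lyapunov function -/

namespace Channel

variable (c : Channel)

lemma plncTime_nonneg {len : ℝ} (hl : 0 < len) (a b : ℕ) : 0 ≤ c.plncTime len a b := by
  have a1 := c.CAD_pos
  have a2 := c.CDB_pos
  have a3 := c.CBD_pos
  have a4 := c.CDA_pos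
  have : 0 ≤ max (a * len / c.CDB) (b * len / c.CDA) := le_max_of_le_left (by positivity)
  unfold plncTime
  positivity

lemma plncTime_eq_mul {len : ℝ} (hl : 0 < len) (a b : ℕ) :
    c.plncTime len a b = len * c.plncTime 1 a b := by
  unfold plncTime
  rw [mul_add, mul_max_of_nonneg _ _ hl.le]
  congr 1
  · ring
  · congr 1 <;> ring

lemma plncTime_mono {len : ℝ} (hl : 0 < len) {a b a' b' : ℕ} (ha : a ≤ a') (hb : b ≤ b') :
    c.plncTime len a b ≤ c.plncTime len a' b' := by
  have a1 := c.CAD_pos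
  have a2 := c.CDB_pos
  have a3 := c.CBD_pos
  have a4 := c.CDA_pos
  have ha' : (a : ℝ) ≤ a' := by exact_mod_cast ha
  have hb' : (b : ℝ) ≤ b' := by exact_mod_cast hb
  unfold plncTime
  gcongr

lemma tdmhTime_eq (len : ℝ) (a b : ℕ) :
    c.tdmhTime len a b = a * len / c.SigAB + b * len / c.SigBA := by
  unfold tdmhTime
  rw [div_eq_mul_one_div (a * len) c.SigAB, div_eq_mul_one_div (b * len) c.SigBA, one_div_SigAB,
    one_div_SigBA]
  ring

lemma tdmhTime_nonneg {len : ℝ} (hl : 0 < len) (a b : ℕ) : 0 ≤ c.tdmhTime len a b := by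
  have a1 := c.SigAB_pos
  have a2 := c.SigBA_pos
  rw [tdmhTime_eq]
  positivity

lemma tdmhTime_mono {len : ℝ} (hl : 0 < len) {a b a' b' : ℕ} (ha : a ≤ a') (hb : b ≤ b') :
    c.tdmhTime len a b ≤ c.tdmhTime len a' b' := by
  have a1 := c.SigAB_pos
  have a2 := c.SigBA_pos
  have ha' : (a : ℝ) ≤ a' := by exact_mod_cast ha
  have hb' : (b : ℝ) ≤ b' := by exact_mod_cast hb
  rw [tdmhTime_eq, tdmhTime_eq]
  gcongr

/-- Both inequalities of the region, without the terms that depend on the threshold. -/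
lemma IsClosestPair.neg_of_mem_oplncRegion {c : Channel} {QA QB Qs : ℕ} {P R : ℝ × ℝ}
    (hP : c.IsClosestPair QA QB P) (hA : 0 < QA) (hB : 0 < QB)
    (hR : R ∈ c.oplncRegion QA QB Qs P) :
    R.1 + P.1 / (c.SigBA - P.2) * (R.2 - c.SigBA) < 0 ∧
      R.2 + P.2 / (c.SigAB - P.1) * (R.1 - c.SigAB) < 0 := by
  obtain ⟨-, -, h1, h2, -⟩ := hR
  have hSA := c.SigAB_pos
  have hSB := c.SigBA_pos
  have hPA : 0 < c.SigAB - P.1 := sub_pos.2 (hP.fst_lt hA hB)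
  have hPB : 0 < c.SigBA - P.2 := sub_pos.2 (hP.snd_lt hA)
  have q1 : (0 : ℝ) ≤ (QA : ℝ) / Qs := by positivity
  have q2 : (0 : ℝ) ≤ (QB : ℝ) / Qs := by positivity
  constructor
  · have e : R.1 + P.1 / (c.SigBA - P.2) * (R.2 - c.SigBA) =
        c.SigBA * (P.1 / (c.SigBA - P.2) * (R.2 / c.SigBA - 1) + R.1 / c.SigBA) := by
      field_simp; ring
    rw [e]
    exact mul_neg_of_pos_of_neg hSB (by linarith)
  · have e : R.2 + P.2 / (c.SigAB - P.1) * (R.1 - c.SigAB) =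
        c.SigAB * (P.2 / (c.SigAB - P.1) * (R.1 / c.SigAB - 1) + R.2 / c.SigAB) := by
      field_simp; ring
    rw [e]
    exact mul_neg_of_pos_of_neg hSA (by linarith)

end Channel

lemma exists_pos_forall_le_neg {a b c d : ℝ} (ha : a < 0) (hb : b < 0) (hc : c < 0) (hd : d < 0) :
    ∃ ε : ℝ, 0 < ε ∧ a ≤ -ε ∧ b ≤ -ε ∧ c ≤ -ε ∧ d ≤ -ε := by
  refine ⟨-max (max a b) (max c d), by simp [*], ?_⟩
  simp

namespace System

variable (S : System)

lemma slotTime_nonneg (q : ℕ × ℕ) : 0 ≤ S.slotTime q := by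
  unfold slotTime
  split_ifs
  · exact S.idle_pos.le
  · unfold Step.time
    split
    · exact S.c.plncTime_nonneg S.len_pos _ _
    · exact S.c.plncTime_nonneg S.len_pos _ _
    · exact S.c.tdmhTime_nonneg S.len_pos _ _
    · exact S.c.tdmhTime_nonneg S.len_pos _ _

lemma coe_slot (q : ℕ × ℕ) : (S.slot q : ℝ) = S.slotTime q :=
  Real.coe_toNNReal _ (S.slotTime_nonneg q)

lemma slotTime_le (hQA : S.QA < S.Qs) (hQB : S.QB < S.Qs) (q : ℕ × ℕ) :
    S.slotTime q ≤ S.idle + S.c.plncTime S.len S.Qs S.Qs + S.c.tdmhTime S.len S.Qs S.Qs := by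
  have h0 := S.idle_pos
  have h1 := S.c.plncTime_nonneg S.len_pos S.Qs S.Qs
  have h2 := S.c.tdmhTime_nonneg S.len_pos S.Qs S.Qs
  obtain ⟨d1, d2⟩ := departures_le_threshold hQA hQB q
  have h3 := S.c.plncTime_mono S.len_pos d1 d2
  have h4 := S.c.tdmhTime_mono S.len_pos d1 d2
  unfold departures at h3 h4
  unfold slotTime
  split_ifs
  · linarith
  · unfold Step.time
    split <;> linarith

/-- Mean change of the queue length at A in the slot that starts in state `q`. -/
noncomputable def driftA (rA : ℝ≥0) (q : ℕ × ℕ) : ℝ := rA * S.slotTime q - (S.departures q).1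

/-- Mean change of the queue length at B in the slot that starts in state `q`. -/
noncomputable def driftB (rB : ℝ≥0) (q : ℕ × ℕ) : ℝ := rB * S.slotTime q - (S.departures q).2

/-- Mean drift in a slot of length `T` with full batches, along `(1, m)`. The pair `(p1, p2)` is at
most the rate pair `(len / T) (QA, QB)` of the slot, and `(1, m)` is normal to the line through
`(p1, p2)` and `(0, σ)`, so `g < 0` says that the arrival rates lie below this line. -/
lemma drift_batch {x y len T QA QB s p1 p2 m σ g : ℝ} (hlen : 0 < len) (hT : 0 < T)
    (hQA : 0 ≤ QA) (hQB : 0 ≤ QB) (hm : 0 ≤ m) (hsT : s * T ≤ len) (hp1 : p1 = s * QA)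
    (hp2 : p2 = s * QB) (hσ : p1 + m * p2 = m * σ)
    (hg : x * len + m * (y * len - σ) = g) :
    (x * T - QA) + m * (y * T - QB) ≤ T / len * g := by
  have h1 : T * (m * σ) ≤ len * (QA + m * QB) := by
    rw [← hσ, hp1, hp2]
    have : 0 ≤ QA + m * QB := by positivity
    nlinarith
  have h2 : T / len * g = x * T + m * (y * T) - T * (m * σ) / len := by
    rw [← hg]; field_simp; ring
  have h3 : T * (m * σ) / len ≤ QA + m * QB := by rw [div_le_iff₀ hlen]; linarith
  linarith

variable {S} in
lemma batch_lt_threshold {P R : ℝ × ℝ} (hR : R ∈ S.c.oplncRegion S.QA S.QB S.Qs P) :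
    S.QA < S.Qs ∧ S.QB < S.Qs := by
  have h : ((max S.QA S.QB : ℕ) : ℝ) < S.Qs := sub_neg.1 hR.2.2.2.2
  exact max_lt_iff.1 (by exact_mod_cast h)

lemma exists_drift_bound (hQA : S.QA < S.Qs) (hQB : S.QB < S.Qs) (rA rB : ℝ≥0) :
    ∃ D : ℝ, 0 ≤ D ∧ (∀ q, |S.driftA rA q| ≤ D) ∧ (∀ q, |S.driftB rB q| ≤ D) ∧
      (∀ q, rA * S.slotTime q ≤ D) ∧ ∀ q, rB * S.slotTime q ≤ D := by
  obtain ⟨τ, hτ⟩ : ∃ τ : ℝ, ∀ q, S.slotTime q ≤ τ := ⟨_, S.slotTime_le hQA hQB⟩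
  have hτ0 : 0 ≤ τ := (S.slotTime_nonneg (0, 0)).trans (hτ (0, 0))
  have b1 : 0 ≤ (rA : ℝ) * τ := by positivity
  have b2 : 0 ≤ (rB : ℝ) * τ := by positivity
  have b3 : (0 : ℝ) ≤ S.Qs := by positivity
  have c1 : ∀ (r : ℝ≥0) q, 0 ≤ r * S.slotTime q ∧ r * S.slotTime q ≤ r * τ := fun r q =>
    ⟨mul_nonneg r.2 (S.slotTime_nonneg q), mul_le_mul_of_nonneg_left (hτ q) r.2⟩
  refine ⟨rA * τ + rB * τ + S.Qs, by positivity, fun q => ?_, fun q => ?_, fun q => ?_,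
    fun q => ?_⟩
  · have e1 : ((S.departures q).1 : ℝ) ≤ S.Qs := by
      exact_mod_cast (departures_le_threshold hQA hQB q).1
    have e2 : (0 : ℝ) ≤ (S.departures q).1 := by positivity
    have := c1 rA q
    rw [driftA, abs_le]; constructor <;> linarith
  · have e1 : ((S.departures q).2 : ℝ) ≤ S.Qs := by
      exact_mod_cast (departures_le_threshold hQA hQB q).2
    have e2 : (0 : ℝ) ≤ (S.departures q).2 := by positivity
    have := c1 rB q
    rw [driftB, abs_le]; constructor <;> linarith
  · linarith [c1 rA q]
  · linarith [c1 rB q]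

/-- The part of the drift of `m x² / 2 + x y + n y² / 2` that is linear in the queue lengths. A
queue shorter than its batch contributes a bounded term; the coefficients of the longer queues are
negative by the two inequalities of the region. -/
lemma drift_linear_le {rA rB : ℝ≥0} {m n s D ε : ℝ} (hQs : 0 < S.Qs) (hm : 0 ≤ m) (hn : 0 ≤ n)
    (hD : 0 ≤ D) (hDA : ∀ q, |S.driftA rA q| ≤ D) (hDB : ∀ q, |S.driftB rB q| ≤ D)
    (hsT : s * S.c.plncTime S.len S.QA S.QB ≤ S.len)
    (hnP : s * S.QA + n * (s * S.QB) = n * S.c.SigBA)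
    (hmP : s * S.QB + m * (s * S.QA) = m * S.c.SigAB)
    (hg₁ : rA * S.len + n * (rB * S.len - S.c.SigBA) < 0)
    (hg₂ : rB * S.len + m * (rA * S.len - S.c.SigAB) < 0) (hε : 0 ≤ ε)
    (hε1 : S.c.plncTime S.len S.QA S.QB / S.len *
      (rA * S.len + n * (rB * S.len - S.c.SigBA)) ≤ -ε)
    (hε2 : S.c.plncTime S.len S.QA S.QB / S.len *
      (rB * S.len + m * (rA * S.len - S.c.SigAB)) ≤ -ε)
    (hε3 : (rA * S.len + n * (rB * S.len - S.c.SigBA)) / S.c.SigBA ≤ -ε)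
    (hε4 : (rB * S.len + m * (rA * S.len - S.c.SigAB)) / S.c.SigAB ≤ -ε) (q : ℕ × ℕ) :
    q.1 * (m * S.driftA rA q + S.driftB rB q) + q.2 * (S.driftA rA q + n * S.driftB rB q) ≤
      S.QA * ((m + 1) * D + ε) + S.QB * ((1 + n) * D + ε) - ε * (q.1 + q.2) := by
  have hA := S.QA_pos
  have hB := S.QB_pos
  have hlen := S.len_pos
  have hSA := S.c.SigAB_pos
  have hSB := S.c.SigBA_pos
  have hQA0 : (0 : ℝ) ≤ S.QA := by positivity
  have hQB0 : (0 : ℝ) ≤ S.QB := by positivity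
  have hT : 0 < S.c.plncTime S.len S.QA S.QB := S.c.plncTime_pos hlen hA
  have q1 : (0 : ℝ) ≤ q.1 := by positivity
  have q2 : (0 : ℝ) ≤ q.2 := by positivity
  have dA := hDA q
  have dB := hDB q
  rw [abs_le] at dA dB
  have u1 : m * S.driftA rA q + S.driftB rB q ≤ (m + 1) * D := by
    linarith [mul_le_mul_of_nonneg_left dA.2 hm]
  have u2 : S.driftA rA q + n * S.driftB rB q ≤ (1 + n) * D := by
    linarith [mul_le_mul_of_nonneg_left dB.2 hn]
  have v1 : 0 ≤ (S.QA : ℝ) * ((m + 1) * D + ε) := by positivity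
  have v2 : 0 ≤ (S.QB : ℝ) * ((1 + n) * D + ε) := by positivity
  have w1 : q.1 ≤ S.QA → q.1 * (m * S.driftA rA q + S.driftB rB q) ≤
      S.QA * ((m + 1) * D + ε) - ε * q.1 := by
    intro h
    have h' : (q.1 : ℝ) ≤ S.QA := by exact_mod_cast h
    have e1 := mul_le_mul_of_nonneg_left u1 q1
    have e2 : (q.1 : ℝ) * ((m + 1) * D + ε) ≤ S.QA * ((m + 1) * D + ε) :=
      mul_le_mul_of_nonneg_right h' (by positivity)
    linarith
  have w2 : q.2 ≤ S.QB → q.2 * (S.driftA rA q + n * S.driftB rB q) ≤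
      S.QB * ((1 + n) * D + ε) - ε * q.2 := by
    intro h
    have h' : (q.2 : ℝ) ≤ S.QB := by exact_mod_cast h
    have e1 := mul_le_mul_of_nonneg_left u2 q2
    have e2 : (q.2 : ℝ) * ((1 + n) * D + ε) ≤ S.QB * ((1 + n) * D + ε) :=
      mul_le_mul_of_nonneg_right h' (by positivity)
    linarith
  have hst := S.step_allowed q
  cases hsq : S.step q <;> rw [hsq] at hst <;> simp only [Step.Allowed] at hst
  · have hq0 : q ≠ (0, 0) := by rintro rfl; simp at hst; omega
    have eτ : S.slotTime q = S.c.plncTime S.len S.QA S.QB := by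
      simp [slotTime, hq0, hsq, Step.time, Step.sent]
    have ed : S.departures q = (S.QA, S.QB) := by simp [departures, hsq, Step.sent]
    have k1 := drift_batch (x := rA) (y := rB) hlen hT hQA0 hQB0 hn hsT rfl rfl hnP rfl
    have k2 := drift_batch (x := rB) (y := rA) hlen hT hQB0 hQA0 hm hsT rfl rfl hmP rfl
    have eA : S.driftA rA q = rA * S.c.plncTime S.len S.QA S.QB - S.QA := by
      rw [driftA, eτ, ed]
    have eB : S.driftB rB q = rB * S.c.plncTime S.len S.QA S.QB - S.QB := by
      rw [driftB, eτ, ed]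
    rw [← eA, ← eB] at k1 k2
    have k3 := mul_le_mul_of_nonneg_left
      (show m * S.driftA rA q + S.driftB rB q ≤ -ε by linarith) q1
    have k4 := mul_le_mul_of_nonneg_left
      (show S.driftA rA q + n * S.driftB rB q ≤ -ε by linarith) q2
    linarith
  · have hq0 : q ≠ (0, 0) := by rintro rfl; simp at hst; omega
    obtain ⟨k, hk⟩ : ∃ k, k = min q.2 S.Qs := ⟨_, rfl⟩
    have hk' : (1 : ℝ) ≤ k := by exact_mod_cast (show 1 ≤ k by omega)
    have eτ : S.slotTime q = k * S.len / S.c.SigBA := by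
      simp [slotTime, hq0, hsq, Step.time, Step.sent, Channel.tdmhTime_eq, hk]
    have ed : S.departures q = (0, k) := by simp [departures, hsq, Step.sent, hk]
    have k1 : S.driftA rA q + n * S.driftB rB q =
        k * ((rA * S.len + n * (rB * S.len - S.c.SigBA)) / S.c.SigBA) := by
      rw [driftA, driftB, eτ, ed]
      simp only [Nat.cast_zero]
      field_simp
      ring
    have k2 : S.driftA rA q + n * S.driftB rB q ≤ -ε := by
      rw [k1]
      refine le_trans ?_ hε3
      have := mul_le_mul_of_nonpos_right hk' (div_neg_of_neg_of_pos hg₁ hSB).le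
      linarith
    have k4 := mul_le_mul_of_nonneg_left k2 q2
    linarith [w1 hst.1.le]
  · have hq0 : q ≠ (0, 0) := by rintro rfl; simp at hst; omega
    obtain ⟨k, hk⟩ : ∃ k, k = min q.1 S.Qs := ⟨_, rfl⟩
    have hk' : (1 : ℝ) ≤ k := by exact_mod_cast (show 1 ≤ k by omega)
    have eτ : S.slotTime q = k * S.len / S.c.SigAB := by
      simp [slotTime, hq0, hsq, Step.time, Step.sent, Channel.tdmhTime_eq, hk]
    have ed : S.departures q = (k, 0) := by simp [departures, hsq, Step.sent, hk]
    have k1 : m * S.driftA rA q + S.driftB rB q =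
        k * ((rB * S.len + m * (rA * S.len - S.c.SigAB)) / S.c.SigAB) := by
      rw [driftA, driftB, eτ, ed]
      simp only [Nat.cast_zero]
      field_simp
      ring
    have k2 : m * S.driftA rA q + S.driftB rB q ≤ -ε := by
      rw [k1]
      refine le_trans ?_ hε4
      have := mul_le_mul_of_nonpos_right hk' (div_neg_of_neg_of_pos hg₂ hSA).le
      linarith
    have k4 := mul_le_mul_of_nonneg_left k2 q1
    linarith [w2 hst.2.le]
  · have := w1 (by omega)
    have := w2 (by omega)
    linarith

/-- The inequalities that define the region say that the quadratic form
`m x² / 2 + x y + n y² / 2`, whose gradient on the `y`-axis is normal to the line through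
`(0, SigBA)` and `P` and on the `x`-axis is normal to the line through `(SigAB, 0)` and `P`,
has negative drift far from the origin: on each axis for the TDMH slots there, and in the
interior, where the gradient is a positive combination of these normals, for the PLNC slots. -/
lemma exists_drift_le {P : ℝ × ℝ} (hP : S.c.IsClosestPair S.QA S.QB P) {rA rB : ℝ≥0}
    (hR : ((rA : ℝ) * S.len, (rB : ℝ) * S.len) ∈ S.c.oplncRegion S.QA S.QB S.Qs P) :
    ∃ m n K ε : ℝ, 0 ≤ m ∧ 0 ≤ n ∧ 0 < ε ∧ ∀ q : ℕ × ℕ,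
      q.1 * (m * S.driftA rA q + S.driftB rB q) + q.2 * (S.driftA rA q + n * S.driftB rB q) +
        (m / 2 * S.driftA rA q ^ 2 + S.driftA rA q * S.driftB rB q +
          n / 2 * S.driftB rB q ^ 2) +
        (m * (rA * S.slotTime q) + n * (rB * S.slotTime q)) / 2 ≤ K - ε * (q.1 + q.2) := by
  have hA := S.QA_pos
  have hB := S.QB_pos
  obtain ⟨hQA, hQB⟩ := batch_lt_threshold hR
  obtain ⟨hg₁, hg₂⟩ := hP.neg_of_mem_oplncRegion hA hB hR
  have hlen := S.len_pos
  have hSA := S.c.SigAB_pos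
  have hSB := S.c.SigBA_pos
  have hPA : 0 < S.c.SigAB - P.1 := sub_pos.2 (hP.fst_lt hA hB)
  have hPB : 0 < S.c.SigBA - P.2 := sub_pos.2 (hP.snd_lt hA)
  obtain ⟨m, hm⟩ : ∃ m, m = P.2 / (S.c.SigAB - P.1) := ⟨_, rfl⟩
  obtain ⟨n, hn⟩ : ∃ n, n = P.1 / (S.c.SigBA - P.2) := ⟨_, rfl⟩
  have hm0 : 0 < m := hm ▸ div_pos (hP.snd_pos hA hB) hPA
  have hn0 : 0 < n := hn ▸ div_pos (hP.fst_pos hA) hPB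
  have hmP : P.2 + m * P.1 = m * S.c.SigAB := by rw [hm]; field_simp; ring
  have hnP : P.1 + n * P.2 = n * S.c.SigBA := by rw [hn]; field_simp; ring
  rw [← hn] at hg₁
  rw [← hm] at hg₂
  simp only at hg₁ hg₂
  obtain ⟨s, hs, hsT, hPs⟩ := hP.exists_smul hA
  have hT : 0 < S.c.plncTime S.len S.QA S.QB := S.c.plncTime_pos hlen hA
  have hsT' : s * S.c.plncTime S.len S.QA S.QB ≤ S.len := by
    rw [S.c.plncTime_eq_mul hlen]
    linarith [mul_le_mul_of_nonneg_left hsT hlen.le]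
  rw [hPs] at hmP hnP
  obtain ⟨ε, hε, hε1, hε2, hε3, hε4⟩ := exists_pos_forall_le_neg
    (mul_neg_of_pos_of_neg (div_pos hT hlen) hg₁) (mul_neg_of_pos_of_neg (div_pos hT hlen) hg₂)
    (div_neg_of_neg_of_pos hg₁ hSB) (div_neg_of_neg_of_pos hg₂ hSA)
  obtain ⟨D, hD0, hDA, hDB, hDa, hDb⟩ := S.exists_drift_bound hQA hQB rA rB
  refine ⟨m, n, S.QA * ((m + 1) * D + ε) + S.QB * ((1 + n) * D + ε) +
    (m / 2 * D ^ 2 + D * D + n / 2 * D ^ 2) + (m * D + n * D) / 2, ε, hm0.le, hn0.le, hε,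
    fun q => ?_⟩
  have lin := S.drift_linear_le (by omega) hm0.le hn0.le hD0 hDA hDB hsT' hnP hmP hg₁ hg₂ hε.le
    hε1 hε2 hε3 hε4 q
  have t1 : S.driftA rA q ^ 2 ≤ D ^ 2 := sq_le_sq' (abs_le.1 (hDA q)).1 (abs_le.1 (hDA q)).2
  have t2 : S.driftB rB q ^ 2 ≤ D ^ 2 := sq_le_sq' (abs_le.1 (hDB q)).1 (abs_le.1 (hDB q)).2
  have t3 : S.driftA rA q * S.driftB rB q ≤ D * D := by
    refine (le_abs_self _).trans ?_
    rw [abs_mul]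
    exact mul_le_mul (hDA q) (hDB q) (abs_nonneg _) hD0
  have t4 := mul_le_mul_of_nonneg_left t1 (half_pos hm0).le
  have t5 := mul_le_mul_of_nonneg_left t2 (half_pos hn0).le
  have t6 := mul_le_mul_of_nonneg_left (hDa q) hm0.le
  have t7 := mul_le_mul_of_nonneg_left (hDb q) hn0.le
  linarith

/-! ### Stability -/

variable {S} {Ω : Type*} [MeasurableSpace Ω] {μ : Measure Ω} [IsProbabilityMeasure μ]
  {rA rB : ℝ≥0} {NA NB : ℝ≥0 → Ω → ℕ}

/-- The mean of a quadratic form after one slot. -/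
lemma integral_quadratic_queue_one (hA : IsPoissonProcess NA rA μ) (hB : IsPoissonProcess NB rB μ)
    (hAB : IndepFun (fun ω t => NA t ω) (fun ω t => NB t ω) μ) (m n : ℝ) (x : ℕ × ℕ) :
    Integrable (fun ω => m / 2 * ((S.queue NA NB x 1 ω).1 : ℝ) ^ 2 +
      (S.queue NA NB x 1 ω).1 * (S.queue NA NB x 1 ω).2 +
      n / 2 * ((S.queue NA NB x 1 ω).2 : ℝ) ^ 2) μ ∧
    ∫ ω, (m / 2 * ((S.queue NA NB x 1 ω).1 : ℝ) ^ 2 +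
      (S.queue NA NB x 1 ω).1 * (S.queue NA NB x 1 ω).2 +
      n / 2 * ((S.queue NA NB x 1 ω).2 : ℝ) ^ 2) ∂μ =
      (m / 2 * (x.1 : ℝ) ^ 2 + x.1 * x.2 + n / 2 * (x.2 : ℝ) ^ 2) +
      (x.1 * (m * S.driftA rA x + S.driftB rB x) + x.2 * (S.driftA rA x + n * S.driftB rB x) +
        (m / 2 * S.driftA rA x ^ 2 + S.driftA rA x * S.driftB rB x +
          n / 2 * S.driftB rB x ^ 2) +
        (m * (rA * S.slotTime x) + n * (rB * S.slotTime x)) / 2) := by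
  obtain ⟨d1, d2⟩ := departures_le (S := S) x
  have lA := hA.law 0 (S.slot x) zero_le
  have lB := hB.law 0 (S.slot x) zero_le
  rw [tsub_zero] at lA lB
  have hind : IndepFun (fun ω => NA (S.slot x) ω - NA 0 ω) (fun ω => NB (S.slot x) ω - NB 0 ω) μ :=
    hAB.comp (φ := fun f : ℝ≥0 → ℕ => f (S.slot x) - f 0)
      (ψ := fun f : ℝ≥0 → ℕ => f (S.slot x) - f 0)
      ((measurable_pi_apply (X := fun _ : ℝ≥0 => ℕ) (S.slot x)).sub (measurable_pi_apply 0))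
      ((measurable_pi_apply (X := fun _ : ℝ≥0 => ℕ) (S.slot x)).sub (measurable_pi_apply 0))
  have h := integral_quadratic_poisson lA lB hind m n
    ((x.1 : ℝ) - (S.departures x).1) ((x.2 : ℝ) - (S.departures x).2)
  have e1 : ∀ ω, ((S.queue NA NB x 1 ω).1 : ℝ) =
      (x.1 : ℝ) - (S.departures x).1 + ((NA (S.slot x) ω - NA 0 ω : ℕ) : ℝ) := by
    intro ω
    rw [← Nat.cast_sub d1, ← Nat.cast_add]
    simp [queue, evolve, slot]
  have e2 : ∀ ω, ((S.queue NA NB x 1 ω).2 : ℝ) =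
      (x.2 : ℝ) - (S.departures x).2 + ((NB (S.slot x) ω - NB 0 ω : ℕ) : ℝ) := by
    intro ω
    rw [← Nat.cast_sub d2, ← Nat.cast_add]
    simp [queue, evolve, slot]
  simp only [e1, e2]
  refine ⟨h.1, h.2.trans ?_⟩
  push_cast
  rw [coe_slot, driftA, driftB]
  ring

/-- The mean passage time to `z` is finite from everywhere, if `z` is the empty state or, because
it is reached in one slot from there, if packets arrive at both nodes. -/
lemma meanPassageTime_queue_lt_top {P : ℝ × ℝ} (hP : S.c.IsClosestPair S.QA S.QB P)
    (hA : IsPoissonProcess NA rA μ) (hB : IsPoissonProcess NB rB μ)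
    (hAB : IndepFun (fun ω t => NA t ω) (fun ω t => NB t ω) μ)
    (hR : ((rA : ℝ) * S.len, (rB : ℝ) * S.len) ∈ S.c.oplncRegion S.QA S.QB S.Qs P)
    {z : ℕ × ℕ} (hz : z = (0, 0) ∨ 0 < rA ∧ 0 < rB) (x : ℕ × ℕ) :
    meanPassageTime (S.queue NA NB x) μ z < ⊤ := by
  have hQs : 0 < S.Qs := Nat.zero_lt_of_lt (batch_lt_threshold hR).1
  obtain ⟨m, n, K, ε, hm, hn, hε, hdrift⟩ := S.exists_drift_le hP hR
  have hmono : ∀ y w : ℕ × ℕ, 0 < S.transProb rA rB y w → ∀ U : Set Ω,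
      {ω | S.queue NA NB y 1 ω = w} ⊆ U → 0 < μ U := by
    intro y w h U hU
    rw [← measure_queue_one hA hB hAB] at h
    exact h.trans_le (measure_mono hU)
  refine (isMarkovFamily_queue hA hB hAB).meanPassageTime_lt_top_of_rank
    (measurableSet_queue hA hB)
    (V := fun q => m / 2 * (q.1 : ℝ) ^ 2 + q.1 * q.2 + n / 2 * (q.2 : ℝ) ^ 2)
    (r := fun q => if q = z then 0 else q.1 + q.2 + 1) (b := K) (N := ⌈(K + 1) / ε⌉₊)
    (fun q => by positivity) (fun q => (integral_quadratic_queue_one hA hB hAB m n q).1)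
    ?_ ?_ ?_ ?_ x
  · intro N
    refine Set.Finite.subset ((Set.finite_Iic ((N, N) : ℕ × ℕ)).union (Set.finite_singleton z)) ?_
    intro q hq
    by_cases hqz : q = z
    · exact Or.inr hqz
    · simp only [hqz, if_false, Set.mem_ofPred_eq] at hq
      exact Or.inl (Prod.mk_le_mk.2 ⟨by omega, by omega⟩)
  · intro y hy
    by_cases hy0 : y = (0, 0)
    · obtain ⟨hrA, hrB⟩ := hz.resolve_left fun h => hy (hy0.trans h.symm)
      subst hy0
      refine hmono _ z (transProb_zero_pos hrA hrB z) _ fun ω hω => ?_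
      have hω' : S.queue NA NB (0, 0) 1 ω = z := hω
      simp [hω', hy]
    · refine hmono y _ (transProb_departures_pos y) _ fun ω hω => ?_
      have hω' : S.queue NA NB y 1 ω = _ := hω
      have h1 := departures_le (S := S) y
      have h2 := departures_pos hQs hy0
      simp only [Set.mem_ofPred_eq, hω', hy, if_false]
      split_ifs <;> omega
  · intro q
    rw [(integral_quadratic_queue_one hA hB hAB m n q).2]
    have := hdrift q
    have : 0 ≤ ε * ((q.1 : ℝ) + q.2) := by positivity
    linarith
  · intro q hq
    rw [(integral_quadratic_queue_one hA hB hAB m n q).2]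
    have h1 := hdrift q
    have h2 : ⌈(K + 1) / ε⌉₊ ≤ q.1 + q.2 := by
      split_ifs at hq <;> omega
    have h3 : (K + 1) / ε ≤ (q.1 : ℝ) + q.2 := (Nat.le_ceil _).trans (by exact_mod_cast h2)
    rw [div_le_iff₀ hε] at h3
    linarith

end System

end TwoWayRelay

theorem theorem5 :
    -- the rate pair closest to the vertex is well defined
    (∀ (c : TwoWayRelay.Channel) (QA QB : ℕ), 0 < QA → 0 < QB →
      ∃! P : ℝ × ℝ, c.IsClosestPair QA QB P) ∧
    -- stability of the queues
    (∀ (S : TwoWayRelay.System) (P : ℝ × ℝ), S.c.IsClosestPair S.QA S.QB P →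
      ∀ (Ω : Type*) [MeasurableSpace Ω] (μ : Measure Ω) [IsProbabilityMeasure μ]
        (rA rB : ℝ≥0) (NA NB : ℝ≥0 → Ω → ℕ),
        TwoWayRelay.IsPoissonProcess NA rA μ → TwoWayRelay.IsPoissonProcess NB rB μ →
        IndepFun (fun ω t => NA t ω) (fun ω t => NB t ω) μ →
        ((rA : ℝ) * S.len, (rB : ℝ) * S.len) ∈ S.c.oplncRegion S.QA S.QB S.Qs P →
        TwoWayRelay.IsMarkovFamily (S.queue NA NB) μ ∧
        TwoWayRelay.IsStable (S.queue NA NB) μ ∧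
        (0 < rA → 0 < rB →
          TwoWayRelay.IsIrreducible (S.queue NA NB) μ ∧
          TwoWayRelay.IsPositiveRecurrent (S.queue NA NB) μ)) ∧
    -- the region lies in the PLNC region and grows with the threshold
    (∀ (c : TwoWayRelay.Channel) (QA QB : ℕ) (P : ℝ × ℝ), 0 < QA → 0 < QB →
      c.IsClosestPair QA QB P →
      (∀ Qs : ℕ, c.oplncRegion QA QB Qs P ⊆ c.plncRegion) ∧
      Monotone fun Qs : ℕ => c.oplncRegion QA QB Qs P) ∧
    -- it converges to the PLNC region if the batch has the traffic pattern of the vertex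
    (∀ (c : TwoWayRelay.Channel) (QA QB : ℕ) (P : ℝ × ℝ), 0 < QA → 0 < QB →
      c.IsClosestPair QA QB P → (QA : ℝ) * c.SigBAB = (QB : ℝ) * c.SigABA →
      Tendsto (fun Qs : ℕ => Metric.hausdorffEDist (c.oplncRegion QA QB Qs P) c.plncRegion)
        atTop (𝓝 0)) ∧
    -- and gets arbitrarily close to it if the batch nearly has this traffic pattern
    (∀ (c : TwoWayRelay.Channel) (ε : ℝ≥0∞), 0 < ε →
      ∃ δ : ℝ, 0 < δ ∧ ∀ (QA QB : ℕ) (P : ℝ × ℝ), 0 < QA → 0 < QB →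
        |(QA : ℝ) / (QB : ℝ) - c.SigABA / c.SigBAB| < δ → c.IsClosestPair QA QB P →
        ∀ᶠ Qs : ℕ in atTop,
          Metric.hausdorffEDist (c.oplncRegion QA QB Qs P) c.plncRegion < ε) := by
  refine ⟨fun c QA QB hA _ => c.existsUnique_isClosestPair QB hA, ?_, ?_, ?_, ?_⟩
  · intro S P hP Ω _ μ _ rA rB NA NB hA hB hAB hR
    refine ⟨TwoWayRelay.System.isMarkovFamily_queue hA hB hAB, ⟨(0, 0), fun x =>
      TwoWayRelay.System.meanPassageTime_queue_lt_top hP hA hB hAB hR (Or.inl rfl) x⟩, ?_⟩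
    intro hrA hrB
    have h := fun x z => TwoWayRelay.System.meanPassageTime_queue_lt_top hP hA hB hAB hR
      (z := z) (Or.inr ⟨hrA, hrB⟩) x
    exact ⟨fun x z => TwoWayRelay.measure_passage_pos (h x z), fun x => h x x⟩
  · intro c QA QB P hA hB hP
    exact ⟨fun Qs => TwoWayRelay.Channel.oplncRegion_subset hP hA hB,
      TwoWayRelay.Channel.oplncRegion_mono⟩
  · intro c QA QB P hA hB hP hV
    refine ENNReal.tendsto_nhds_zero.2 fun ε hε => ?_
    obtain ⟨δ, hδ, h⟩ := TwoWayRelay.Channel.eventually_hausdorffEDist_lt c hε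
    have e : (QA : ℝ) / QB = c.SigABA / c.SigBAB := by
      have hB' : (QB : ℝ) ≠ 0 := by exact_mod_cast hB.ne'
      rw [div_eq_div_iff hB' c.SigBAB_pos.ne', hV, mul_comm]
    filter_upwards [h QA QB P hA hB (by rw [e]; simpa using hδ) hP] with Qs hQs using hQs.le
  · intro c ε hε
    exact TwoWayRelay.Channel.eventually_hausdorffEDist_lt c hε
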